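/- Let $0<\gamma<3$, $p\ge 2$ and $\frac{5+\gamma}{3}<p<3+\gamma$. For $u\in H^1(\mathbb{R}^3;\mathbb{C})$ put $$M(u)=\int_{\mathbb{R}^3}|u|^2\,dx,\qquad P(u)=\int_{\mathbb{R}^3}\Big(\int_{\mathbb{R}^3}\frac{|u(y)|^p}{|x-y|^{3-\gamma}}\,dy\Big)|u(x)|^p\,dx,$$ and let $$A=3+\gamma-p,\qquad B=3p-(3+\gamma),\qquad s_c=\frac32-\frac{\gamma+2}{2(p-1)},\qquad \sigma_c=\frac{1-s_c}{s_c}.$$ A *ground state* is a nonzero $Q\in H^1(\mathbb{R}^3;\mathbb{C})$ which is a weak solution of $$-Q+\Delta Q+(I_\gamma*|Q|^p)|Q|^{p-2}Q=0,\qquad I_\gamma(x)=|x|^{-(3-\gamma)},$$ and an optimizer of the Gagliardo–Nirenberg inequality $P(v)\le C\|v\|_2^A\|\nabla v\|_2^B$, i.e. $Q$ maximizes $P(v)/(\|v\|_2^A\|\nabla v\|_2^B)$ over all nonzero $v\in H^1(\mathbb{R}^3;\mathbb{C})$. A *cutoff* is a radial function $\chi\in C^\infty(\mathbb{R}^3;\mathbb{R})$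 with $\chi=1$ on $|x|\le\frac12$, with support in $|x|\le 1$, and nonincreasing in $|x|$ on $\frac12\le|x|\le1$; for $R>0$ put $\chi_R(x)=\chi(x/R)$. Then for every $\delta>0$ there is $\delta'>0$, depending only on $\delta$, $p$ and $\gamma$, such that for every ground state $Q$ and every $u\in H^1(\mathbb{R}^3;\mathbb{C})$ with $$P(u)M(u)^{\sigma_c}<(1-\delta)\,P(Q)M(Q)^{\sigma_c}$$ the following hold. 1. (Coercivity) $\ \|\nabla u\|_2^2-\dfrac{B}{2p}P(u)\ \ge\ \delta' P(u).$ 2. (Coercivity on balls) For every cutoff $\chi$ and every $R>0$, $\chi_R u\in H^1(\mathbb{R}^3;\mathbb{C})$ and $$\|\nabla(\chi_R u)\|_2^2-\frac{B}{2p}P(\chi_R u)\ \ge\ \delta' P(\chi_R u).$$ -/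

import Mathlib

open MeasureTheory
open scoped ENNReal ContDiff

noncomputable section

namespace Hartree

/-- Three-dimensional Euclidean space. -/
abbrev E3 : Type := EuclideanSpace ℝ (Fin 3)

/-- Smooth compactly supported real test functions. -/
def IsTest (φ : E3 → ℝ) : Prop := ContDiff ℝ ∞ φ ∧ HasCompactSupport φ

/-- The classical partial derivative `∂ᵢ φ`. -/
def partialDeriv (i : Fin 3) (φ : E3 → ℝ) (x : E3) : ℝ :=
  fderiv ℝ φ x (EuclideanSpace.single i 1)

/-- `g` is a weak (distributional) gradient of `u`: both are locally integrable and
`∫ u ∂ᵢφ = - ∫ gᵢ φ` for all test functions `φ` and `i = 1, 2, 3`. -/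
def IsWeakGrad (u : E3 → ℂ) (g : E3 → EuclideanSpace ℂ (Fin 3)) : Prop :=
  LocallyIntegrable u volume ∧ LocallyIntegrable g volume ∧
    ∀ (i : Fin 3) (φ : E3 → ℝ), IsTest φ →
      ∫ x, partialDeriv i φ x • u x = - ∫ x, φ x • g x i

/-- `u ∈ H¹(ℝ³; ℂ)`: `u` is square integrable and has a square integrable weak gradient. -/
def MemH1 (u : E3 → ℂ) : Prop :=
  MemLp u 2 volume ∧ ∃ g, IsWeakGrad u g ∧ MemLp g 2 volume

open Classical in
/-- The weak gradient `∇u` (unique up to null sets; `0` if there is none, which does not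
happen for `u ∈ H¹`). -/
def weakGrad (u : E3 → ℂ) : E3 → EuclideanSpace ℂ (Fin 3) :=
  if h : ∃ g, IsWeakGrad u g then h.choose else 0

/-- The mass `M(u) = ‖u‖₂²`. -/
def mass (u : E3 → ℂ) : ℝ := ∫ x, ‖u x‖ ^ 2

/-- `‖∇u‖₂²`. -/
def gradSq (u : E3 → ℂ) : ℝ := ∫ x, ‖weakGrad u x‖ ^ 2

/-- `(I_γ ∗ |u|^p)(x) = ∫ |u(y)|^p / |x - y|^(3-γ) dy`, as an extended nonnegative number. -/
def rieszPow (γ p : ℝ) (u : E3 → ℂ) (x : E3) : ℝ≥0∞ :=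
  ∫⁻ y, ENNReal.ofReal (‖u y‖ ^ p / ‖x - y‖ ^ (3 - γ))

/-- The potential energy `P(u) = ∫ (I_γ ∗ |u|^p) |u|^p` (finite for `u ∈ H¹` when
`0 < γ < 3`, `2 ≤ p` and `p < 3 + γ`). -/
def potential (γ p : ℝ) (u : E3 → ℂ) : ℝ :=
  (∫⁻ x, rieszPow γ p u x * ENNReal.ofReal (‖u x‖ ^ p)).toReal

/-- `A = 3 + γ - p`. -/
def expA (γ p : ℝ) : ℝ := 3 + γ - p

/-- `B = 3p - (3 + γ)`. -/
def expB (γ p : ℝ) : ℝ := 3 * p - (3 + γ)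

/-- The critical exponent `s_c = 3/2 - (γ + 2) / (2 (p - 1))`. -/
def sCrit (γ p : ℝ) : ℝ := 3 / 2 - (γ + 2) / (2 * (p - 1))

/-- `σ_c = (1 - s_c) / s_c`. -/
def sigmaCrit (γ p : ℝ) : ℝ := (1 - sCrit γ p) / sCrit γ p

/-- The Gagliardo–Nirenberg quotient `P(v) / (‖v‖₂^A ‖∇v‖₂^B)`; its supremum over
`v ∈ H¹ \ {0}` is the best constant in `P(v) ≤ C ‖v‖₂^A ‖∇v‖₂^B`. -/
def gnQuotient (γ p : ℝ) (v : E3 → ℂ) : ℝ :=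
  potential γ p v / (√(mass v) ^ expA γ p * √(gradSq v) ^ expB γ p)

/-- `Q` solves `-Q + ΔQ + (I_γ ∗ |Q|^p) |Q|^(p-2) Q = 0` in the weak sense. -/
def SolvesElliptic (γ p : ℝ) (Q : E3 → ℂ) : Prop :=
  ∀ φ : E3 → ℝ, IsTest φ →
    -(∫ x, φ x • Q x) - (∑ i : Fin 3, ∫ x, partialDeriv i φ x • weakGrad Q x i)
      + ∫ x, φ x • (((rieszPow γ p Q x).toReal * ‖Q x‖ ^ (p - 2)) • Q x) = 0

/-- `Q` is a ground state: a nonzero `H¹` solution of the elliptic equation which is an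
optimizer of the Gagliardo–Nirenberg inequality. Neither uniqueness, positivity nor
radial symmetry of `Q` is required. -/
structure IsGroundState (γ p : ℝ) (Q : E3 → ℂ) : Prop where
  memH1 : MemH1 Q
  ne_zero : ¬ Q =ᵐ[volume] 0
  solves : SolvesElliptic γ p Q
  optimizer : ∀ v : E3 → ℂ, MemH1 v → ¬ v =ᵐ[volume] 0 →
    gnQuotient γ p v ≤ gnQuotient γ p Q

/-- `χ` is a smooth radial cutoff: `1` on `|x| ≤ 1/2`, supported in `|x| ≤ 1`, and
(weakly) decreasing in `|x|` for `1/2 ≤ |x| ≤ 1`. -/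
structure IsCutoff (χ : E3 → ℝ) : Prop where
  smooth : ContDiff ℝ ∞ χ
  radial : ∀ x y : E3, ‖x‖ = ‖y‖ → χ x = χ y
  eq_one : ∀ x : E3, ‖x‖ ≤ 1 / 2 → χ x = 1
  support : tsupport χ ⊆ Metric.closedBall 0 1
  decreasing : ∀ x y : E3, 1 / 2 ≤ ‖x‖ → ‖x‖ ≤ ‖y‖ → ‖y‖ ≤ 1 → χ y ≤ χ x

/-- The localization `χ_R u`, where `χ_R(x) = χ(x / R)`. -/
def localize (χ : E3 → ℝ) (R : ℝ) (u : E3 → ℂ) : E3 → ℂ :=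
  fun x => χ (R⁻¹ • x) • u x

end Hartree

end

open Filter Topology

noncomputable section

namespace Hartree

/-! ### Weak gradients -/

/-! Let x, m, g be the ratios of P, M and ‖∇·‖₂² of a function v to those of a ground state Q.
Optimality of Q turns Gagliardo–Nirenberg into x ≤ m^(A/2) g^(B/2). Since σ_c = A/(B-2), the
threshold x m^σ_c ≤ θ eliminates m: x^(B/2) = x^((B-2)/2) x ≤ θ^((B-2)/2) g^(B/2), so x ≤
θ^((B-2)/B) g (`le_rpow_mul_of_gn`). With the Pohozaev identity ‖∇Q‖₂² = B/(2p) P(Q) this reads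
B/(2p) P(v) ≤ θ^((B-2)/B) ‖∇v‖₂², and θ = 1-δ < 1 leaves a gap depending only on δ, p, γ. Localizing
decreases |u| pointwise, hence P and M, so χ_R u obeys the same threshold.

The Pohozaev identity (`IsGroundState.gradSq_eq`) is proved without multiplying the equation by
x·∇Q, which would require regularity and decay. Optimality yields an Euler–Lagrange equation with
the same nonlinearity as the elliptic equation. Eliminating that nonlinearity leaves aQ = bΔQ
weakly, and b = 0 is the identity. If b ≠ 0, then Q is an L² eigenfunction of the Laplacian: its
Fourier transform is carried by a null sphere, so Q = 0 (`ae_eq_zero_of_laplacian_eq`).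

Since `potential` is the `toReal` of an extended integral, finiteness must come before positivity,
monotonicity and differentiation. Hardy–Littlewood–Sobolev is avoided: the existence of an optimizer
bounds P on bounded H¹ functions, whose energy is finite by direct estimates, and mollification with
Fatou's lemma extends the bound to H¹ (`IsGroundState.energy_lt_top`). -/

theorem IsTest.continuous {φ : E3 → ℝ} (h : IsTest φ) : Continuous φ := h.1.continuous

theorem IsTest.continuous_partialDeriv {φ : E3 → ℝ} (h : IsTest φ) (i : Fin 3) :
    Continuous (partialDeriv i φ) :=
  (h.1.continuous_fderiv (by simp)).clm_apply continuous_const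

theorem IsTest.hasCompactSupport_partialDeriv {φ : E3 → ℝ} (h : IsTest φ) (i : Fin 3) :
    HasCompactSupport (partialDeriv i φ) :=
  (h.2.fderiv_apply ℝ _)

theorem integrable_test_smul {F : Type*} [NormedAddCommGroup F] [NormedSpace ℝ F]
    {φ : E3 → ℝ} (hφ : Continuous φ) (hc : HasCompactSupport φ) {u : E3 → F}
    (hu : LocallyIntegrable u volume) : Integrable (fun x => φ x • u x) volume :=
  hu.integrable_smul_left_of_hasCompactSupport hφ hc

theorem locallyIntegrable_comp {g : E3 → EuclideanSpace ℂ (Fin 3)}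
    (hg : LocallyIntegrable g volume) (i : Fin 3) :
    LocallyIntegrable (fun x => g x i) volume := by
  intro x
  obtain ⟨s, hs, h⟩ := hg x
  exact ⟨s, hs, (EuclideanSpace.proj (𝕜 := ℂ) i).integrable_comp h⟩

/-- `weakGrad` is an arbitrary choice; uniqueness allows `gradSq` to be computed from any explicit
weak gradient. -/
theorem IsWeakGrad.ae_unique {u : E3 → ℂ} {g g' : E3 → EuclideanSpace ℂ (Fin 3)}
    (h : IsWeakGrad u g) (h' : IsWeakGrad u g') : g =ᵐ[volume] g' := by
  have key : ∀ i : Fin 3, ∀ᵐ x, g x i = g' x i := fun i =>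
    ae_eq_of_integral_contDiff_smul_eq (locallyIntegrable_comp h.2.1 i)
      (locallyIntegrable_comp h'.2.1 i) fun φ h1 h2 => by
        have e1 := h.2.2 i φ ⟨h1, h2⟩
        have e2 := h'.2.2 i φ ⟨h1, h2⟩
        rw [e1] at e2
        exact neg_injective e2
  filter_upwards [ae_all_iff.2 key] with x hx
  ext i
  exact hx i

theorem weakGrad_spec {u : E3 → ℂ} (h : ∃ g, IsWeakGrad u g) : IsWeakGrad u (weakGrad u) := by
  rw [weakGrad, dif_pos h]
  exact h.choose_spec

theorem IsWeakGrad.weakGrad_ae_eq {u : E3 → ℂ} {g : E3 → EuclideanSpace ℂ (Fin 3)}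
    (h : IsWeakGrad u g) : weakGrad u =ᵐ[volume] g :=
  (weakGrad_spec ⟨g, h⟩).ae_unique h

theorem IsWeakGrad.gradSq_eq {u : E3 → ℂ} {g : E3 → EuclideanSpace ℂ (Fin 3)}
    (h : IsWeakGrad u g) : gradSq u = ∫ x, ‖g x‖ ^ 2 :=
  integral_congr_ae (h.weakGrad_ae_eq.mono fun x hx => by simp only [hx])

theorem MemH1.isWeakGrad {u : E3 → ℂ} (h : MemH1 u) : IsWeakGrad u (weakGrad u) :=
  weakGrad_spec ⟨h.2.choose, h.2.choose_spec.1⟩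

theorem MemH1.memLp_weakGrad {u : E3 → ℂ} (h : MemH1 u) : MemLp (weakGrad u) 2 volume := by
  obtain ⟨g, hg, hg2⟩ := h.2
  exact hg2.ae_eq hg.weakGrad_ae_eq.symm

theorem IsWeakGrad.add {u v : E3 → ℂ} {g h : E3 → EuclideanSpace ℂ (Fin 3)}
    (hu : IsWeakGrad u g) (hv : IsWeakGrad v h) :
    IsWeakGrad (fun x => u x + v x) (fun x => g x + h x) := by
  refine ⟨hu.1.add hv.1, hu.2.1.add hv.2.1, fun i φ hφ => ?_⟩
  have hd := hφ.continuous_partialDeriv i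
  have hdc := hφ.hasCompactSupport_partialDeriv i
  simp only [smul_add, PiLp.add_apply]
  rw [integral_add (integrable_test_smul hd hdc hu.1) (integrable_test_smul hd hdc hv.1),
    integral_add (integrable_test_smul hφ.continuous hφ.2 (locallyIntegrable_comp hu.2.1 i))
      (integrable_test_smul hφ.continuous hφ.2 (locallyIntegrable_comp hv.2.1 i)),
    hu.2.2 i φ hφ, hv.2.2 i φ hφ, neg_add]

/-- The gradient of a smooth real function, as a complex vector field. -/
def cgrad (φ : E3 → ℝ) (x : E3) : EuclideanSpace ℂ (Fin 3) :=
  WithLp.toLp 2 fun i => (partialDeriv i φ x : ℂ)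

@[simp] theorem cgrad_apply (φ : E3 → ℝ) (x : E3) (i : Fin 3) :
    cgrad φ x i = (partialDeriv i φ x : ℂ) := rfl

theorem continuous_cgrad {φ : E3 → ℝ} (h : ContDiff ℝ ∞ φ) : Continuous (cgrad φ) := by
  refine (PiLp.continuous_toLp 2 _).comp (continuous_pi fun i => ?_)
  exact Complex.continuous_ofReal.comp
    ((h.continuous_fderiv (by simp)).clm_apply continuous_const)

theorem IsTest.hasCompactSupport_cgrad {φ : E3 → ℝ} (h : IsTest φ) :
    HasCompactSupport (cgrad φ) := by
  have := h.2.fderiv ℝ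
  refine this.mono' ?_
  refine subset_trans (fun x hx => ?_) (subset_tsupport _)
  contrapose! hx
  simp only [Function.mem_support, not_not] at hx ⊢
  ext i
  simp [Hartree.partialDeriv, hx]

theorem integral_partialDeriv_mul {φ : E3 → ℝ} {f : E3 → ℂ} (hφ : IsTest φ)
    (hf : ContDiff ℝ 1 f) (i : Fin 3) :
    ∫ x, partialDeriv i φ x • f x =
      - ∫ x, φ x • fderiv ℝ f x (EuclideanSpace.single i 1) := by
  have h := integral_smul_fderiv_eq_neg_fderiv_smul_of_integrable (μ := volume) (𝕜 := ℝ)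
    (f := φ) (g := f) (v := EuclideanSpace.single i 1) ?_ ?_ ?_
    (fun x _ => (hφ.1.differentiable (by simp)) x) (fun x _ => hf.differentiable (by simp) x)
  · rw [h, neg_neg]; rfl
  · exact integrable_test_smul (hφ.continuous_partialDeriv i)
      (hφ.hasCompactSupport_partialDeriv i) hf.continuous.locallyIntegrable
  · exact integrable_test_smul hφ.continuous hφ.2
      ((hf.continuous_fderiv (by simp)).clm_apply continuous_const).locallyIntegrable
  · exact integrable_test_smul hφ.continuous hφ.2 hf.continuous.locallyIntegrable

theorem isWeakGrad_of_contDiff {f : E3 → ℂ} {g : E3 → EuclideanSpace ℂ (Fin 3)}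
    (hf : ContDiff ℝ 1 f) (hg : LocallyIntegrable g volume)
    (h : ∀ x i, g x i = fderiv ℝ f x (EuclideanSpace.single i 1)) : IsWeakGrad f g := by
  refine ⟨hf.continuous.locallyIntegrable, hg, fun i φ hφ => ?_⟩
  simp only [h]
  exact integral_partialDeriv_mul hφ hf i

theorem IsTest.isWeakGrad_smul {φ : E3 → ℝ} (h : IsTest φ) (c : ℂ) :
    IsWeakGrad (fun x => φ x • c) (fun x => c • cgrad φ x) := by
  have h1 : ContDiff ℝ 1 φ := h.1.of_le (by simp)
  refine isWeakGrad_of_contDiff (h1.smul contDiff_const)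
    ((continuous_cgrad h.1).const_smul c).locallyIntegrable fun x i => ?_
  rw [fderiv_smul_const ((h1.differentiable (by simp)) x)]
  simp [Hartree.partialDeriv, mul_comm]

theorem IsTest.memLp_smul {φ : E3 → ℝ} (h : IsTest φ) (c : ℂ) :
    MemLp (fun x => φ x • c) 2 volume :=
  (h.continuous.smul continuous_const).memLp_of_hasCompactSupport h.2.smul_right

theorem IsTest.memLp_cgrad {φ : E3 → ℝ} (h : IsTest φ) (c : ℂ) :
    MemLp (fun x => c • cgrad φ x) 2 volume :=
  ((continuous_cgrad h.1).const_smul c).memLp_of_hasCompactSupport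
    (h.hasCompactSupport_cgrad.mono fun x hx => by
      contrapose! hx
      simp only [Function.mem_support, not_not] at hx ⊢
      simp [hx])

theorem partialDeriv_mul {χ φ : E3 → ℝ} (hχ : ContDiff ℝ ∞ χ) (hφ : ContDiff ℝ ∞ φ)
    (i : Fin 3) (x : E3) :
    partialDeriv i (fun x => χ x * φ x) x =
      χ x * partialDeriv i φ x + φ x * partialDeriv i χ x := by
  simp only [partialDeriv]
  rw [fderiv_fun_mul (hχ.differentiable (by simp) x) (hφ.differentiable (by simp) x)]
  simp

theorem IsTest.mul_left {χ φ : E3 → ℝ} (hφ : IsTest φ) (hχ : ContDiff ℝ ∞ χ) :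
    IsTest (fun x => χ x * φ x) :=
  ⟨hχ.mul hφ.1, hφ.2.mul_left⟩

/-- The product rule for a smooth function times a weakly differentiable one. -/
theorem IsWeakGrad.smul_smooth {χ : E3 → ℝ} (hχ : ContDiff ℝ ∞ χ) {u : E3 → ℂ}
    {g : E3 → EuclideanSpace ℂ (Fin 3)} (h : IsWeakGrad u g) :
    IsWeakGrad (fun x => χ x • u x) (fun x => χ x • g x + u x • cgrad χ x) := by
  have hi1 : LocallyIntegrable (fun x => χ x • u x) volume := h.1.continuous_smul hχ.continuous
  have hi2 : LocallyIntegrable (fun x => χ x • g x) volume := h.2.1.continuous_smul hχ.continuous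
  have hi3 : LocallyIntegrable (fun x => u x • cgrad χ x) volume :=
    h.1.smul_continuous (continuous_cgrad hχ)
  refine ⟨hi1, hi2.add hi3, fun i φ hφ => ?_⟩
  have hd := hφ.continuous_partialDeriv i
  have hdc := hφ.hasCompactSupport_partialDeriv i
  have h1 := h.2.2 i _ (hφ.mul_left hχ)
  have i1 := integrable_test_smul hd hdc hi1
  have i2 : Integrable (fun x => (φ x * partialDeriv i χ x) • u x) volume := by
    refine integrable_test_smul ?_ hφ.2.mul_right h.1
    exact hφ.continuous.mul ((hχ.continuous_fderiv (by simp)).clm_apply continuous_const)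
  have i3 : Integrable (fun x => φ x • χ x • g x i) volume :=
    integrable_test_smul hφ.continuous hφ.2 (locallyIntegrable_comp hi2 i)
  have e1 : ∫ x, partialDeriv i (fun x => χ x * φ x) x • u x =
      (∫ x, partialDeriv i φ x • χ x • u x) + ∫ x, (φ x * partialDeriv i χ x) • u x := by
    rw [← integral_add i1 i2]
    refine integral_congr_ae (.of_forall fun x => ?_)
    simp only [partialDeriv_mul hχ hφ.1, add_smul, smul_smul, mul_comm]
  have e2 : ∫ x, φ x • (χ x • g x + u x • cgrad χ x) i =
      (∫ x, φ x • χ x • g x i) + ∫ x, (φ x * partialDeriv i χ x) • u x := by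
    rw [← integral_add i3 i2]
    refine integral_congr_ae (.of_forall fun x => ?_)
    simp
    ring
  have e3 : ∫ x, (χ x * φ x) • g x i = ∫ x, φ x • χ x • g x i :=
    integral_congr_ae (.of_forall fun x => by simp only [smul_smul, mul_comm])
  rw [e2, ← e3, neg_add, ← h1, e1]
  ring


/-! ### Cutoffs -/

theorem IsCutoff.eq_zero {χ : E3 → ℝ} (h : IsCutoff χ) {x : E3} (hx : 1 < ‖x‖) : χ x = 0 := by
  by_contra h0
  have := h.support (subset_tsupport _ h0)
  rw [mem_closedBall_zero_iff] at this
  linarith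

/-- The support condition gives zero only outside the closed ball; continuity along (1 + 1/(n+1))x
reaches the sphere. -/
theorem IsCutoff.eq_zero_of_norm_eq_one {χ : E3 → ℝ} (h : IsCutoff χ) {x : E3} (hx : ‖x‖ = 1) :
    χ x = 0 := by
  have ht : Tendsto (fun n : ℕ => (1 + 1 / ((n : ℝ) + 1)) • x) atTop (𝓝 ((1 + 0 : ℝ) • x)) :=
    (tendsto_const_nhds.add tendsto_one_div_add_atTop_nhds_zero_nat).smul tendsto_const_nhds
  rw [add_zero, one_smul] at ht
  have h2 := (h.smooth.continuous.tendsto x).comp ht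
  refine tendsto_nhds_unique h2 (tendsto_const_nhds.congr fun n => ?_)
  refine (h.eq_zero ?_).symm
  have : (0 : ℝ) < 1 / ((n : ℝ) + 1) := by positivity
  rw [norm_smul, hx, mul_one, Real.norm_of_nonneg (by linarith)]
  linarith

theorem IsCutoff.mem_Icc {χ : E3 → ℝ} (h : IsCutoff χ) (x : E3) : 0 ≤ χ x ∧ χ x ≤ 1 := by
  -- On the annulus, monotonicity compares x with a unit vector, where χ = 0, and with its half,
  -- where χ = 1.
  let e : E3 := EuclideanSpace.single 0 1
  have he : ‖e‖ = 1 := by simp [e]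
  have he2 : ‖(1 / 2 : ℝ) • e‖ = 1 / 2 := by rw [norm_smul, he]; norm_num
  rcases le_or_gt ‖x‖ (1 / 2) with h1 | h1
  · simp [h.eq_one x h1]
  rcases le_or_gt ‖x‖ 1 with h2 | h2
  · have a := h.decreasing x e h1.le (by rw [he]; exact h2) he.le
    rw [h.eq_zero_of_norm_eq_one he] at a
    have b := h.decreasing ((1 / 2 : ℝ) • e) x he2.ge (by rw [he2]; exact h1.le) h2
    rw [h.eq_one _ he2.le] at b
    exact ⟨a, b⟩
  · simp [h.eq_zero h2]

theorem IsCutoff.hasCompactSupport {χ : E3 → ℝ} (h : IsCutoff χ) : HasCompactSupport χ :=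
  (isCompact_closedBall 0 1).of_isClosed_subset (isClosed_tsupport _) h.support

theorem IsCutoff.isTest_scale {χ : E3 → ℝ} (h : IsCutoff χ) {R : ℝ} (hR : 0 < R) :
    IsTest fun x => χ (R⁻¹ • x) :=
  ⟨h.smooth.comp (contDiff_const_smul _), h.hasCompactSupport.comp_smul (inv_ne_zero hR.ne')⟩

theorem norm_localize_le {χ : E3 → ℝ} (h : IsCutoff χ) (R : ℝ) (u : E3 → ℂ) (x : E3) :
    ‖localize χ R u x‖ ≤ ‖u x‖ := by
  obtain ⟨h0, h1⟩ := h.mem_Icc (R⁻¹ • x)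
  rw [localize, norm_smul, Real.norm_of_nonneg h0]
  exact mul_le_of_le_one_left (norm_nonneg _) h1

theorem MemH1.smul_test {χ : E3 → ℝ} (hχ : IsTest χ) {u : E3 → ℂ} (hu : MemH1 u) :
    MemH1 fun x => χ x • u x := by
  obtain ⟨g, hg, hg2⟩ := hu.2
  have bdd : ∀ {F : Type} [NormedAddCommGroup F] (f : E3 → F), Continuous f →
      HasCompactSupport f → ∃ C, ∀ x, ‖f x‖ ≤ C := fun f hf hc =>
    hc.exists_bound_of_continuous hf
  obtain ⟨C, hC⟩ := bdd χ hχ.continuous hχ.2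
  obtain ⟨C', hC'⟩ := bdd (cgrad χ) (continuous_cgrad hχ.1) hχ.hasCompactSupport_cgrad
  refine ⟨hu.1.of_le_mul (c := C) (hχ.continuous.aestronglyMeasurable.smul hu.1.1)
    (.of_forall fun x => ?_), _, hg.smul_smooth hχ.1, ?_⟩
  · rw [norm_smul]
    exact mul_le_mul_of_nonneg_right (hC x) (norm_nonneg _)
  refine MemLp.add (hg2.of_le_mul (c := C) (hχ.continuous.aestronglyMeasurable.smul hg2.1)
    (.of_forall fun x => ?_)) (hu.1.of_le_mul (c := C')
      (hu.1.1.smul (continuous_cgrad hχ.1).aestronglyMeasurable) (.of_forall fun x => ?_))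
  · rw [norm_smul]
    exact mul_le_mul_of_nonneg_right (hC x) (norm_nonneg _)
  · rw [norm_smul, mul_comm]
    exact mul_le_mul_of_nonneg_right (hC' x) (norm_nonneg _)

theorem MemH1.localize {χ : E3 → ℝ} (h : IsCutoff χ) {R : ℝ} (hR : 0 < R) {u : E3 → ℂ}
    (hu : MemH1 u) : MemH1 (localize χ R u) :=
  hu.smul_test (h.isTest_scale hR)

/-! ### Mass and gradient norm -/

theorem mass_nonneg (u : E3 → ℂ) : 0 ≤ mass u := integral_nonneg fun _ => by positivity

theorem gradSq_nonneg (u : E3 → ℂ) : 0 ≤ gradSq u := integral_nonneg fun _ => by positivity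

theorem integrable_norm_sq {F : Type*} [NormedAddCommGroup F] {f : E3 → F}
    (hf : MemLp f 2 volume) : Integrable (fun x => ‖f x‖ ^ 2) volume :=
  hf.integrable_norm_pow (p := 2) two_ne_zero

theorem integral_norm_sq_eq_zero {F : Type*} [NormedAddCommGroup F] {f : E3 → F}
    (hf : MemLp f 2 volume) (h : ∫ x, ‖f x‖ ^ 2 = 0) : f =ᵐ[volume] 0 := by
  rw [integral_eq_zero_iff_of_nonneg (fun _ => by positivity) (integrable_norm_sq hf)] at h
  filter_upwards [h] with x hx
  simpa using hx

theorem mass_pos {u : E3 → ℂ} (hu : MemH1 u) (h0 : ¬ u =ᵐ[volume] 0) : 0 < mass u :=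
  (mass_nonneg u).lt_of_ne fun h => h0 (integral_norm_sq_eq_zero hu.1 h.symm)

theorem mass_le_of_norm_le {u v : E3 → ℂ} (hu : MemLp u 2 volume)
    (h : ∀ x, ‖v x‖ ≤ ‖u x‖) : mass v ≤ mass u :=
  integral_mono_of_nonneg (.of_forall fun _ => by positivity)
    (integrable_norm_sq hu) (.of_forall fun x => pow_le_pow_left₀ (norm_nonneg _) (h x) 2)

/-! ### Mollification -/

/-- Mollification of `f` by the normalized bump function `η`. -/
def mollify {F : Type*} [NormedAddCommGroup F] [NormedSpace ℝ F]
    (η : ContDiffBump (0 : E3)) (f : E3 → F) : E3 → F :=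
  convolution (η.normed volume) f (ContinuousLinearMap.lsmul ℝ ℝ) volume

theorem integral_norm_sq_eq {F : Type*} [NormedAddCommGroup F] {f : E3 → F} (hf : AEStronglyMeasurable f volume) :
    ∫ x, ‖f x‖ ^ 2 = (∫⁻ x, ‖f x‖ₑ ^ 2).toReal := by
  have hm : AEStronglyMeasurable (fun x => ‖f x‖ ^ 2) volume := hf.norm.pow 2
  rw [integral_eq_lintegral_of_nonneg_ae (.of_forall fun _ => by positivity) hm]
  congr 1
  refine lintegral_congr fun x => ?_
  rw [ENNReal.ofReal_pow (norm_nonneg _), ofReal_norm]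

section

variable {F : Type*} [NormedAddCommGroup F] [NormedSpace ℝ F] (η : ContDiffBump (0 : E3))

theorem mollify_apply (f : E3 → F) (x : E3) :
    mollify η f x = ∫ y, η.normed volume (x - y) • f y := by
  rw [mollify, convolution_lsmul_swap]

theorem contDiff_mollify [CompleteSpace F] {f : E3 → F} (hf : LocallyIntegrable f volume) :
    ContDiff ℝ ∞ (mollify η f) :=
  HasCompactSupport.contDiff_convolution_left _ η.hasCompactSupport_normed η.contDiff_normed hf

theorem isTest_normed_sub (x : E3) : IsTest fun y => η.normed volume (x - y) := by
  refine ⟨η.contDiff_normed.comp (contDiff_const.sub contDiff_id), ?_⟩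
  exact η.hasCompactSupport_normed.comp_homeomorph (Homeomorph.subLeft x)

theorem fderiv_mollify {f : E3 → ℂ} (hf : LocallyIntegrable f volume) (x : E3) (v : E3) :
    fderiv ℝ (mollify η f) x v = ∫ y, fderiv ℝ (η.normed volume) (x - y) v • f y := by
  have h := HasCompactSupport.hasFDerivAt_convolution_left
    (ContinuousLinearMap.lsmul ℝ ℝ (E := ℂ)) (μ := volume)
    (η.hasCompactSupport_normed (μ := volume))
    ((η.contDiff_normed (μ := volume) (n := 1))) hf x
  have h2 := h.fderiv
  rw [mollify, h2, convolution_eq_swap, ContinuousLinearMap.integral_apply]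
  · rfl
  · exact (HasCompactSupport.convolutionExists_left _
      ((η.hasCompactSupport_normed (μ := volume)).fderiv ℝ)
      ((η.contDiff_normed (μ := volume) (n := 1)).continuous_fderiv (by simp)) hf x).integrable_swap

/-- The weak identity is tested against y ↦ η(x - y); the chain-rule sign cancels the sign of
integration by parts. -/
theorem IsWeakGrad.mollify {u : E3 → ℂ} {g : E3 → EuclideanSpace ℂ (Fin 3)}
    (h : IsWeakGrad u g) : IsWeakGrad (mollify η u) (mollify η g) := by
  refine isWeakGrad_of_contDiff ((contDiff_mollify η h.1).of_le (by simp))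
    (contDiff_mollify η h.2.1).continuous.locallyIntegrable fun x i => ?_
  have ht := isTest_normed_sub η x
  have hi : ∀ y, partialDeriv i (fun y => η.normed volume (x - y)) y =
      - fderiv ℝ (η.normed volume) (x - y) (EuclideanSpace.single i 1) := fun y => by
    have h1 : HasFDerivAt (fun y : E3 => x - y) (-ContinuousLinearMap.id ℝ E3) y :=
      (hasFDerivAt_id y).const_sub x
    have h2 : HasFDerivAt (η.normed volume) (fderiv ℝ (η.normed volume) (x - y)) (x - y) :=
      ((η.contDiff_normed (μ := volume) (n := 1)).differentiable (by simp) _).hasFDerivAt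
    have h3 : HasFDerivAt (fun y => η.normed volume (x - y)) _ y := h2.comp y h1
    rw [partialDeriv, h3.fderiv]
    simp
  have e := h.2.2 i _ ht
  simp only [hi, neg_smul, integral_neg, neg_inj] at e
  rw [fderiv_mollify η h.1, e, mollify_apply]
  have := (EuclideanSpace.proj (𝕜 := ℂ) i).integral_comp_comm
    (integrable_test_smul ht.continuous ht.2 h.2.1)
  simpa using this.symm

theorem lintegral_ofReal_normed : ∫⁻ y, ENNReal.ofReal (η.normed volume y) = 1 := by
  rw [← ofReal_integral_eq_lintegral_ofReal η.integrable_normed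
    (.of_forall η.nonneg_normed), η.integral_normed, ENNReal.ofReal_one]

/-- Jensen's inequality for the probability density η, obtained from Cauchy–Schwarz after splitting
η = η^(1/2) η^(1/2). -/
theorem enorm_mollify_sq_le {f : E3 → F} (hf : AEStronglyMeasurable f volume) (x : E3) :
    ‖mollify η f x‖ₑ ^ 2 ≤
      ∫⁻ y, ENNReal.ofReal (η.normed volume y) * ‖f (x - y)‖ₑ ^ 2 := by
  set w : E3 → ℝ≥0∞ := fun y => ENNReal.ofReal (η.normed volume y) with hw
  have hwm : Measurable w := η.continuous_normed.measurable.ennreal_ofReal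
  have hfm : AEMeasurable (fun y => ‖f (x - y)‖ₑ) volume :=
    (hf.comp_quasiMeasurePreserving
      (quasiMeasurePreserving_sub_left volume x)).enorm
  have hsq : ∀ a : ℝ≥0∞, (a ^ (1 / 2 : ℝ)) ^ (2 : ℝ) = a := fun a => by
    rw [← ENNReal.rpow_mul]; norm_num
  have hH := ENNReal.lintegral_mul_le_Lp_mul_Lq volume (p := 2) (q := 2)
    (by constructor <;> norm_num) (f := fun y => w y ^ (1 / 2 : ℝ))
    (g := fun y => w y ^ (1 / 2 : ℝ) * ‖f (x - y)‖ₑ) (hwm.pow_const _).aemeasurable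
    ((hwm.pow_const _).aemeasurable.mul hfm)
  have hL : ∀ y, ((fun y => w y ^ (1 / 2 : ℝ)) * fun y => w y ^ (1 / 2 : ℝ) * ‖f (x - y)‖ₑ) y =
      w y * ‖f (x - y)‖ₑ := fun y => by
    have h2 : w y ^ (1 / 2 : ℝ) * w y ^ (1 / 2 : ℝ) = w y := by
      rw [← sq, ← ENNReal.rpow_two, hsq]
    rw [Pi.mul_apply, ← mul_assoc, h2]
  simp only [hL, hsq, ENNReal.mul_rpow_of_nonneg _ _ (zero_le_two : (0 : ℝ) ≤ 2)] at hH
  rw [lintegral_ofReal_normed, ENNReal.one_rpow, one_mul] at hH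
  calc ‖mollify η f x‖ₑ ^ 2 ≤ (∫⁻ y, w y * ‖f (x - y)‖ₑ) ^ 2 := by
        gcongr
        refine (enorm_integral_le_lintegral_enorm _).trans (lintegral_mono fun y => ?_)
        rw [ContinuousLinearMap.lsmul_apply, enorm_smul, Real.enorm_of_nonneg (η.nonneg_normed y)]
    _ ≤ ((∫⁻ y, w y * ‖f (x - y)‖ₑ ^ (2 : ℝ)) ^ (1 / 2 : ℝ)) ^ 2 := by gcongr
    _ = _ := by
        rw [← ENNReal.rpow_two, hsq]
        simp only [ENNReal.rpow_two, hw]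

/-- Integrate the pointwise Jensen bound; Tonelli and translation invariance leave the total mass 1
of η. -/
theorem lintegral_enorm_mollify_sq_le {f : E3 → F} (hf : AEStronglyMeasurable f volume) :
    ∫⁻ x, ‖mollify η f x‖ₑ ^ 2 ≤ ∫⁻ x, ‖f x‖ₑ ^ 2 := by
  calc ∫⁻ x, ‖mollify η f x‖ₑ ^ 2
      ≤ ∫⁻ x, ∫⁻ y, ENNReal.ofReal (η.normed volume y) * ‖f (x - y)‖ₑ ^ 2 :=
        lintegral_mono fun x => enorm_mollify_sq_le η hf x
    _ = ∫⁻ y, ∫⁻ x, ENNReal.ofReal (η.normed volume y) * ‖f (x - y)‖ₑ ^ 2 := by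
        refine lintegral_lintegral_swap (AEMeasurable.fun_mul ?_ ?_)
        · exact (η.continuous_normed.measurable.ennreal_ofReal.comp measurable_snd).aemeasurable
        · exact (hf.comp_quasiMeasurePreserving
            (quasiMeasurePreserving_sub volume volume)).enorm.pow_const 2
    _ = ∫⁻ y, ENNReal.ofReal (η.normed volume y) * ∫⁻ x, ‖f x‖ₑ ^ 2 := by
        refine lintegral_congr fun y => ?_
        rw [lintegral_const_mul' _ _ ENNReal.ofReal_ne_top,
          lintegral_sub_right_eq_self (fun x => ‖f x‖ₑ ^ 2) y]
    _ = ∫⁻ x, ‖f x‖ₑ ^ 2 := by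
        rw [lintegral_mul_const _ η.continuous_normed.measurable.ennreal_ofReal, lintegral_ofReal_normed, one_mul]

theorem memLp_mollify [CompleteSpace F] {f : E3 → F} (hf : MemLp f 2 volume) :
    MemLp (mollify η f) 2 volume := by
  have hl := hf.locallyIntegrable one_le_two
  refine ⟨(contDiff_mollify η hl).continuous.aestronglyMeasurable, ?_⟩
  rw [eLpNorm_lt_top_iff_lintegral_rpow_enorm_lt_top (by simp) (by simp)]
  have h2 := hf.2
  rw [eLpNorm_lt_top_iff_lintegral_rpow_enorm_lt_top (by simp) (by simp)] at h2
  simp only [ENNReal.toReal_ofNat, ENNReal.rpow_ofNat] at h2 ⊢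
  exact (lintegral_enorm_mollify_sq_le η hf.1).trans_lt h2

theorem integral_norm_mollify_sq_le [CompleteSpace F] {f : E3 → F} (hf : MemLp f 2 volume) :
    ∫ x, ‖mollify η f x‖ ^ 2 ≤ ∫ x, ‖f x‖ ^ 2 := by
  rw [integral_norm_sq_eq hf.1, integral_norm_sq_eq (memLp_mollify η hf).1]
  refine ENNReal.toReal_mono ?_ (lintegral_enorm_mollify_sq_le η hf.1)
  have h2 := hf.2
  rw [eLpNorm_lt_top_iff_lintegral_rpow_enorm_lt_top (by simp) (by simp)] at h2
  simpa using h2.ne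

/-- Bounding η by its supremum in the Jensen estimate gives |η ∗ f|² ≤ sup η · ‖f‖₂². Boundedness is
what makes the Riesz energy of a mollification visibly finite. -/
theorem exists_norm_mollify_le {f : E3 → F} (hf : MemLp f 2 volume) :
    ∃ C : ℝ, ∀ x, ‖mollify η f x‖ ≤ C := by
  obtain ⟨S, hS⟩ := (η.hasCompactSupport_normed (μ := volume)).exists_bound_of_continuous
    η.continuous_normed
  have h2 := hf.2
  rw [eLpNorm_lt_top_iff_lintegral_rpow_enorm_lt_top (by simp) (by simp)] at h2
  simp only [ENNReal.toReal_ofNat, ENNReal.rpow_ofNat] at h2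
  set T := ENNReal.ofReal S * ∫⁻ x, ‖f x‖ₑ ^ 2 with hT
  have hTt : T ≠ ⊤ := ENNReal.mul_ne_top ENNReal.ofReal_ne_top h2.ne
  have key : ∀ x, ‖mollify η f x‖ₑ ^ 2 ≤ T := fun x => by
    refine (enorm_mollify_sq_le η hf.1 x).trans ?_
    rw [hT, ← lintegral_sub_left_eq_self (fun y => ‖f y‖ₑ ^ 2) x,
      ← lintegral_const_mul' _ _ ENNReal.ofReal_ne_top]
    refine lintegral_mono fun y => mul_le_mul_left (ENNReal.ofReal_le_ofReal ?_) _
    exact (le_abs_self _).trans (hS y)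
  refine ⟨√T.toReal, fun x => Real.le_sqrt_of_sq_le ?_⟩
  have := ENNReal.toReal_mono hTt (key x)
  simpa using this

end

/-- A sequence of bump functions shrinking to the origin. -/
def bumpSeq (n : ℕ) : ContDiffBump (0 : E3) where
  rIn := 1 / (n + 1)
  rOut := 2 * (1 / (n + 1))
  rIn_pos := by positivity
  rIn_lt_rOut := by
    have : (0 : ℝ) < 1 / (n + 1) := by positivity
    linarith

theorem ae_tendsto_mollify {F : Type*} [NormedAddCommGroup F] [NormedSpace ℝ F]
    [CompleteSpace F] {f : E3 → F} (hf : LocallyIntegrable f volume) :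
    ∀ᵐ x, Tendsto (fun n => mollify (bumpSeq n) f x) atTop (𝓝 (f x)) := by
  -- `K` bounds the ratio of outer to inner radius, which is exactly 2 for `bumpSeq`.
  refine ContDiffBump.ae_convolution_tendsto_right_of_locallyIntegrable (K := 2) ?_
    (.of_forall fun n => le_rfl) hf
  simpa [bumpSeq] using (tendsto_one_div_add_atTop_nhds_zero_nat (𝕜 := ℝ)).const_mul 2

/-- Mollification commutes with the weak gradient and contracts L², so a Gagliardo–Nirenberg bound
for u holds uniformly along its mollifications. -/
theorem MemH1.mollify {u : E3 → ℂ} (hu : MemH1 u) (η : ContDiffBump (0 : E3)) :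
    MemH1 (mollify η u) ∧ mass (Hartree.mollify η u) ≤ mass u ∧
      gradSq (Hartree.mollify η u) ≤ gradSq u := by
  have hg := hu.isWeakGrad.mollify η
  refine ⟨⟨memLp_mollify η hu.1, _, hg, memLp_mollify η hu.memLp_weakGrad⟩,
    integral_norm_mollify_sq_le η hu.1, ?_⟩
  rw [hg.gradSq_eq]
  exact integral_norm_mollify_sq_le η hu.memLp_weakGrad

/-! ### The Riesz energy -/

/-- The Riesz kernel `|z|^(γ-3)`. -/
def riesz (γ : ℝ) (z : E3) : ℝ≥0∞ := ENNReal.ofReal ((‖z‖ ^ (3 - γ))⁻¹)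

theorem measurable_riesz (γ : ℝ) : Measurable (riesz γ) := by
  unfold riesz
  fun_prop

theorem riesz_neg (γ : ℝ) (z : E3) : riesz γ (-z) = riesz γ z := by simp [riesz]

theorem riesz_sub_comm (γ : ℝ) (x y : E3) : riesz γ (x - y) = riesz γ (y - x) := by
  rw [← riesz_neg, neg_sub]

theorem riesz_ne_top (γ : ℝ) (z : E3) : riesz γ z ≠ ⊤ := ENNReal.ofReal_ne_top

theorem riesz_pos {γ : ℝ} {z : E3} (hz : z ≠ 0) : 0 < riesz γ z :=
  ENNReal.ofReal_pos.2 (inv_pos.2 (Real.rpow_pos_of_pos (norm_pos_iff.2 hz) _))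

theorem riesz_le_one {γ : ℝ} (hγ : γ < 3) {z : E3} (hz : 1 ≤ ‖z‖) : riesz γ z ≤ 1 := by
  rw [riesz, ← ENNReal.ofReal_one]
  exact ENNReal.ofReal_le_ofReal (inv_le_one_of_one_le₀ (Real.one_le_rpow hz (by linarith)))

/-- In polar coordinates the integrand is r² r^(γ-3) = r^(γ-1), integrable at 0 because γ > 0. -/
theorem lintegral_riesz_unitBall_lt_top {γ : ℝ} (hγ0 : 0 < γ) :
    ∫⁻ z in Metric.ball (0 : E3) 1, riesz γ z < ⊤ := by
  have h : IntegrableOn (fun z : E3 => (‖z‖ ^ (3 - γ))⁻¹) (Metric.ball 0 1) volume := by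
    refine (integrableOn_fun_norm_addHaar (E := E3) volume
      (f := fun r : ℝ => (r ^ (3 - γ))⁻¹) (r := 1)).2 ?_
    refine ((intervalIntegral.integrableOn_Ioo_rpow_iff zero_lt_one).2
      (by linarith : -1 < γ - 1)).congr_fun (fun r hr => ?_) measurableSet_Ioo
    simp only [finrank_euclideanSpace, Fintype.card_fin, smul_eq_mul]
    rw [← Real.rpow_neg hr.1.le, ← Real.rpow_natCast, ← Real.rpow_add hr.1]
    congr 1
    norm_num
    ring
  exact h.lintegral_lt_top

/-- The bilinear Riesz energy. -/
def energy (γ : ℝ) (f g : E3 → ℝ≥0∞) : ℝ≥0∞ :=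
  ∫⁻ z : E3 × E3, f z.1 * g z.2 * riesz γ (z.1 - z.2)

/-- The Riesz potential of a nonnegative function. -/
def rieszPot (γ : ℝ) (f : E3 → ℝ≥0∞) (x : E3) : ℝ≥0∞ := ∫⁻ y, f y * riesz γ (x - y)

/-- `|u|^p` as an extended nonnegative function. -/
def powNorm (p : ℝ) (u : E3 → ℂ) (x : E3) : ℝ≥0∞ := ENNReal.ofReal (‖u x‖ ^ p)

theorem aemeasurable_powNorm {p : ℝ} {u : E3 → ℂ} (hu : AEStronglyMeasurable u volume) :
    AEMeasurable (powNorm p u) volume :=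
  (hu.norm.aemeasurable.pow_const p).ennreal_ofReal

theorem aemeasurable_energy_integrand {γ : ℝ} {f g : E3 → ℝ≥0∞} (hf : AEMeasurable f volume)
    (hg : AEMeasurable g volume) :
    AEMeasurable (fun z : E3 × E3 => f z.1 * g z.2 * riesz γ (z.1 - z.2)) volume :=
  ((hf.comp_quasiMeasurePreserving Measure.quasiMeasurePreserving_fst).mul
    (hg.comp_quasiMeasurePreserving Measure.quasiMeasurePreserving_snd)).mul
    ((measurable_riesz γ).comp (measurable_fst.sub measurable_snd)).aemeasurable

theorem aemeasurable_rieszPot_integrand {γ : ℝ} {f : E3 → ℝ≥0∞} (hf : AEMeasurable f volume)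
    (x : E3) : AEMeasurable (fun y => f y * riesz γ (x - y)) volume :=
  hf.fun_mul ((measurable_riesz γ).comp (measurable_const.sub measurable_id)).aemeasurable

theorem aemeasurable_rieszPot {γ : ℝ} {f : E3 → ℝ≥0∞} (hf : AEMeasurable f volume) :
    AEMeasurable (rieszPot γ f) volume := by
  have : AEMeasurable (fun z : E3 × E3 => f z.2 * riesz γ (z.1 - z.2)) (volume.prod volume) :=
    (hf.comp_quasiMeasurePreserving Measure.quasiMeasurePreserving_snd).fun_mul
      ((measurable_riesz γ).comp (measurable_fst.sub measurable_snd)).aemeasurable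
  exact this.lintegral_prod_right'

theorem energy_eq {γ : ℝ} {f g : E3 → ℝ≥0∞} (hf : AEMeasurable f volume)
    (hg : AEMeasurable g volume) : energy γ f g = ∫⁻ x, f x * rieszPot γ g x := by
  rw [energy, Measure.volume_eq_prod, lintegral_prod _ (aemeasurable_energy_integrand hf hg)]
  refine lintegral_congr fun x => ?_
  simp only [mul_assoc]
  rw [lintegral_const_mul'' _ (aemeasurable_rieszPot_integrand hg x)]
  rfl

theorem rieszPow_eq (γ p : ℝ) (u : E3 → ℂ) (x : E3) :
    rieszPow γ p u x = rieszPot γ (powNorm p u) x :=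
  lintegral_congr fun y => by
    rw [powNorm, riesz, ← ENNReal.ofReal_mul (by positivity), div_eq_mul_inv]

theorem potential_eq {γ p : ℝ} {u : E3 → ℂ} (hu : AEStronglyMeasurable u volume) :
    potential γ p u = (energy γ (powNorm p u) (powNorm p u)).toReal := by
  rw [potential, energy_eq (aemeasurable_powNorm hu) (aemeasurable_powNorm hu)]
  simp only [rieszPow_eq, mul_comm, powNorm]

theorem energy_mono {γ : ℝ} {f f' g g' : E3 → ℝ≥0∞} (hf : ∀ x, f x ≤ f' x)
    (hg : ∀ x, g x ≤ g' x) : energy γ f g ≤ energy γ f' g' :=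
  lintegral_mono fun z => by gcongr; exacts [hf _, hg _]

theorem energy_comm (γ : ℝ) (f g : E3 → ℝ≥0∞) : energy γ f g = energy γ g f := by
  rw [energy, Measure.volume_eq_prod, ← lintegral_prod_swap]
  refine lintegral_congr fun z => ?_
  simp only [Prod.fst_swap, Prod.snd_swap, riesz_sub_comm γ z.2, mul_comm (f z.2)]

/-- Split the kernel at distance 1: near the singularity use the bound on f and local integrability,
far away use that the kernel is at most 1. -/
theorem rieszPot_le {γ : ℝ} (hγ : γ < 3) {f : E3 → ℝ≥0∞} {C : ℝ≥0∞} (hC : ∀ x, f x ≤ C)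
    (x : E3) :
    rieszPot γ f x ≤ C * (∫⁻ z in Metric.ball (0 : E3) 1, riesz γ z) + ∫⁻ y, f y := by
  have hs : rieszPot γ f x = ∫⁻ z, f (x - z) * riesz γ z := by
    rw [rieszPot, ← lintegral_sub_left_eq_self _ x]
    simp
  rw [hs, ← lintegral_add_compl _ (measurableSet_ball (x := (0 : E3)) (ε := 1)),
    ← lintegral_sub_left_eq_self f x, ← lintegral_const_mul _ (measurable_riesz γ)]
  refine add_le_add (lintegral_mono fun z => mul_le_mul_left (hC _) _) ?_
  · refine (setLIntegral_mono' measurableSet_ball.compl fun z hz => ?_).trans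
      (setLIntegral_le_lintegral _ _)
    have : 1 ≤ ‖z‖ := by simpa using hz
    exact mul_le_of_le_one_right' (riesz_le_one hγ this)

theorem energy_lt_top_of_bounded {γ : ℝ} (hγ0 : 0 < γ) (hγ : γ < 3) {f : E3 → ℝ≥0∞}
    (hf : AEMeasurable f volume) {C : ℝ≥0∞} (hC : C ≠ ⊤) (hb : ∀ x, f x ≤ C)
    (hi : ∫⁻ x, f x < ⊤) : energy γ f f < ⊤ := by
  rw [energy_eq hf hf]
  set K := C * (∫⁻ z in Metric.ball (0 : E3) 1, riesz γ z) + ∫⁻ y, f y with hK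
  have hKt : K < ⊤ := ENNReal.add_lt_top.2
    ⟨ENNReal.mul_lt_top hC.lt_top (lintegral_riesz_unitBall_lt_top hγ0), hi⟩
  calc ∫⁻ x, f x * rieszPot γ f x ≤ ∫⁻ x, f x * K :=
        lintegral_mono fun x => mul_le_mul_right (rieszPot_le hγ hb x) _
    _ = (∫⁻ x, f x) * K := lintegral_mul_const'' _ hf
    _ < ⊤ := ENNReal.mul_lt_top hi hKt

/-- The energy of a bounded square integrable function is finite. -/
theorem energy_powNorm_lt_top_of_bounded {γ p : ℝ} (hγ0 : 0 < γ) (hγ : γ < 3) (hp : 2 ≤ p)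
    {u : E3 → ℂ} (hu : MemLp u 2 volume) {C : ℝ} (hC : ∀ x, ‖u x‖ ≤ C) :
    energy γ (powNorm p u) (powNorm p u) < ⊤ := by
  have hC0 : 0 ≤ C := (norm_nonneg _).trans (hC 0)
  refine energy_lt_top_of_bounded hγ0 hγ (aemeasurable_powNorm hu.1)
    (C := ENNReal.ofReal (C ^ p)) ENNReal.ofReal_ne_top
    (fun x => ENNReal.ofReal_le_ofReal
      (Real.rpow_le_rpow (norm_nonneg _) (hC x) (by linarith))) ?_
  -- As p ≥ 2, boundedness gives |u|^p ≤ C^(p-2) |u|², so |u|^p is integrable.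
  have hle : ∀ x, powNorm p u x ≤ ENNReal.ofReal (C ^ (p - 2) * ‖u x‖ ^ 2) := fun x => by
    refine ENNReal.ofReal_le_ofReal ?_
    have h0 : ‖u x‖ ^ p = ‖u x‖ ^ (p - 2) * ‖u x‖ ^ 2 := by
      rw [← Real.rpow_natCast, ← Real.rpow_add_of_nonneg (norm_nonneg _) (by linarith) (by simp)]
      simp
    rw [h0]
    exact mul_le_mul_of_nonneg_right
      (Real.rpow_le_rpow (norm_nonneg _) (hC x) (by linarith)) (by positivity)
  exact (lintegral_mono hle).trans_lt
    ((integrable_norm_sq hu).const_mul _).lintegral_lt_top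

/-- If f is not null, some x has f(x) ≠ 0 and vanishing Riesz potential; the kernel is positive off
x, which forces f = 0 almost everywhere. -/
theorem ae_eq_zero_of_energy_eq_zero {γ : ℝ} {f : E3 → ℝ≥0∞}
    (hf : AEMeasurable f volume) (h : energy γ f f = 0) : f =ᵐ[volume] 0 := by
  rw [energy_eq hf hf, lintegral_eq_zero_iff' (hf.fun_mul (aemeasurable_rieszPot hf))] at h
  by_contra hne
  have : ∃ x, f x ≠ 0 ∧ f x * rieszPot γ f x = 0 := by
    by_contra! hcon
    refine hne ?_
    filter_upwards [h] with x hx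
    by_contra h0
    exact hcon x h0 hx
  obtain ⟨x, hx, hx0⟩ := this
  have h1 : rieszPot γ f x = 0 := (mul_eq_zero.1 hx0).resolve_left hx
  rw [rieszPot, lintegral_eq_zero_iff' (aemeasurable_rieszPot_integrand hf x)] at h1
  refine hne ?_
  filter_upwards [h1, (measure_singleton x : volume {x} = 0) |> measure_eq_zero_iff_ae_notMem.1]
    with y hy hyx
  refine (mul_eq_zero.1 hy).resolve_right (riesz_pos ?_).ne'
  rw [sub_ne_zero]
  exact fun e => hyx e.symm

/-- Lower semicontinuity of the energy under almost everywhere convergence. -/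
theorem energy_le_of_ae_tendsto {γ : ℝ} {f : E3 → ℝ≥0∞} {F : ℕ → E3 → ℝ≥0∞}
    (hF : ∀ n, AEMeasurable (F n) volume) (hfin : ∀ x, f x ≠ ⊤)
    (hlim : ∀ᵐ x, Tendsto (fun n => F n x) atTop (𝓝 (f x))) {K : ℝ≥0∞}
    (hK : ∀ n, energy γ (F n) (F n) ≤ K) : energy γ f f ≤ K := by
  have h1 : ∀ᵐ z : E3 × E3, Tendsto (fun n => F n z.1) atTop (𝓝 (f z.1)) :=
    Measure.quasiMeasurePreserving_fst.ae hlim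
  have h2 : ∀ᵐ z : E3 × E3, Tendsto (fun n => F n z.2) atTop (𝓝 (f z.2)) :=
    Measure.quasiMeasurePreserving_snd.ae hlim
  calc energy γ f f
      = ∫⁻ z : E3 × E3, liminf (fun n => F n z.1 * F n z.2 * riesz γ (z.1 - z.2)) atTop := by
        refine lintegral_congr_ae ?_
        filter_upwards [h1, h2] with z a b
        refine (Tendsto.liminf_eq ?_).symm
        -- Multiplication on the extended half-line is continuous here because all the limits are
        -- finite.
        exact ENNReal.Tendsto.mul_const (ENNReal.Tendsto.mul a (.inr (hfin _)) b (.inr (hfin _)))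
          (.inr (riesz_ne_top _ _))
    _ ≤ liminf (fun n => energy γ (F n) (F n)) atTop :=
        lintegral_liminf_le' fun n => aemeasurable_energy_integrand (hF n) (hF n)
    _ ≤ K := liminf_le_of_le (by isBoundedDefault) fun b hb => by
        obtain ⟨n, hn⟩ := hb.exists
        exact hn.trans (hK n)

/-! ### From test functions to Schwartz functions -/

theorem memLp_mul_integrable {a b : E3 → ℂ} (ha : MemLp a 2 volume) (hb : MemLp b 2 volume) :
    Integrable (fun x => a x * b x) volume :=
  ha.integrable_mul hb

/-- The `i`-th standard basis vector. -/
abbrev basisVec (i : Fin 3) : E3 := EuclideanSpace.single i 1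

/-- The hypothesis concerns real test functions, while Schwartz functions are complex; real and
imaginary parts bridge the two. -/
theorem integral_complex_test_eq_zero {h : E3 → ℂ} {k : Fin 3 → E3 → ℂ}
    (hh : LocallyIntegrable h volume) (hk : ∀ i, LocallyIntegrable (k i) volume)
    (H : ∀ φ, IsTest φ → (∫ x, φ x • h x) + ∑ i, ∫ x, partialDeriv i φ x • k i x = 0)
    {φ : E3 → ℂ} (hφ : ContDiff ℝ ∞ φ) (hc : HasCompactSupport φ) :
    (∫ x, φ x * h x) + ∑ i, ∫ x, fderiv ℝ φ x (basisVec i) * k i x = 0 := by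
  have hre : IsTest fun x => (φ x).re :=
    ⟨Complex.reCLM.contDiff.comp hφ, hc.comp_left (g := Complex.re) rfl⟩
  have him : IsTest fun x => (φ x).im :=
    ⟨Complex.imCLM.contDiff.comp hφ, hc.comp_left (g := Complex.im) rfl⟩
  have hd : Differentiable ℝ φ := hφ.differentiable (by simp)
  have dre : ∀ i x, partialDeriv i (fun x => (φ x).re) x = (fderiv ℝ φ x (basisVec i)).re :=
    fun i x => by
      have : HasFDerivAt (fun x => (φ x).re) (Complex.reCLM ∘L fderiv ℝ φ x) x :=
        Complex.reCLM.hasFDerivAt.comp x (hd x).hasFDerivAt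
      rw [partialDeriv, this.fderiv]
      rfl
  have dim : ∀ i x, partialDeriv i (fun x => (φ x).im) x = (fderiv ℝ φ x (basisVec i)).im :=
    fun i x => by
      have : HasFDerivAt (fun x => (φ x).im) (Complex.imCLM ∘L fderiv ℝ φ x) x :=
        Complex.imCLM.hasFDerivAt.comp x (hd x).hasFDerivAt
      rw [partialDeriv, this.fderiv]
      rfl
  have split : ∀ (z w : ℂ), z * w = z.re • w + Complex.I * (z.im • w) := fun z w => by
    conv_lhs => rw [← Complex.re_add_im z]
    simp only [Complex.real_smul]
    ring
  have e0 : ∫ x, φ x * h x =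
      (∫ x, (φ x).re • h x) + Complex.I * ∫ x, (φ x).im • h x := by
    rw [← integral_const_mul, ← integral_add (integrable_test_smul hre.continuous hre.2 hh)
      ((integrable_test_smul him.continuous him.2 hh).const_mul _)]
    exact integral_congr_ae (.of_forall fun x => split _ _)
  have e1 : ∀ i, ∫ x, fderiv ℝ φ x (basisVec i) * k i x =
      (∫ x, partialDeriv i (fun x => (φ x).re) x • k i x) +
        Complex.I * ∫ x, partialDeriv i (fun x => (φ x).im) x • k i x := fun i => by
    rw [← integral_const_mul, ← integral_add
      (integrable_test_smul (hre.continuous_partialDeriv i)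
        (hre.hasCompactSupport_partialDeriv i) (hk i))
      ((integrable_test_smul (him.continuous_partialDeriv i)
        (him.hasCompactSupport_partialDeriv i) (hk i)).const_mul _)]
    refine integral_congr_ae (.of_forall fun x => ?_)
    simp only [dre, dim]
    exact split _ _
  simp only [e0, e1, Finset.sum_add_distrib, ← Finset.mul_sum]
  have a1 := H _ hre
  have a2 := H _ him
  linear_combination a1 + Complex.I * a2

/-- Apply the identity to χ(εx)ψ(x) and let ε → 0. Square integrability of h and k supplies the
dominating functions. -/
theorem integral_schwartz_eq_zero {h : E3 → ℂ} {k : Fin 3 → E3 → ℂ}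
    (hh : MemLp h 2 volume) (hk : ∀ i, MemLp (k i) 2 volume)
    (H : ∀ φ, IsTest φ → (∫ x, φ x • h x) + ∑ i, ∫ x, partialDeriv i φ x • k i x = 0)
    (ψ : SchwartzMap E3 ℂ) :
    (∫ x, ψ x * h x) + ∑ i, ∫ x, fderiv ℝ ψ x (basisVec i) * k i x = 0 := by
  let χ : ContDiffBump (0 : E3) := ⟨1, 2, one_pos, one_lt_two⟩
  have hχs : ContDiff ℝ ∞ (χ : E3 → ℝ) := χ.contDiff
  have hχc : HasCompactSupport (χ : E3 → ℝ) := χ.hasCompactSupport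
  let ε : ℕ → ℝ := fun n => 1 / ((n : ℝ) + 1)
  have hε0 : ∀ n, 0 < ε n := fun n => by positivity
  -- This bounds the derivative falling on the cutoff uniformly in n; its factor ε also sends that
  -- term to 0.
  have hε1 : ∀ n, ε n ≤ 1 := fun n => by
    refine (div_le_one (by positivity)).2 ?_
    linarith [n.cast_nonneg (α := ℝ)]
  have hεt : Tendsto ε atTop (𝓝 0) := tendsto_one_div_add_atTop_nhds_zero_nat
  obtain ⟨S, hS⟩ := (hχc.fderiv ℝ).exists_bound_of_continuous (hχs.continuous_fderiv (by simp))
  have hψd : Differentiable ℝ ψ := ψ.differentiable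
  let Φ : ℕ → E3 → ℂ := fun n x => χ (ε n • x) • ψ x
  have hd : ∀ n x i, fderiv ℝ (Φ n) x (basisVec i) = χ (ε n • x) • fderiv ℝ ψ x (basisVec i) +
      (ε n * fderiv ℝ χ (ε n • x) (basisVec i)) • ψ x := fun n x i => by
    have h1 : HasFDerivAt (fun x : E3 => ε n • x) (ε n • ContinuousLinearMap.id ℝ E3) x :=
      (hasFDerivAt_id x).const_smul (ε n)
    have h2 : HasFDerivAt (fun x : E3 => χ (ε n • x)) _ x :=
      ((hχs.differentiable (by simp)) (ε n • x)).hasFDerivAt.comp x h1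
    have h3 : HasFDerivAt (Φ n) _ x := h2.smul (hψd x).hasFDerivAt
    rw [h3.fderiv]
    simp
  have hz : ∀ n, (∫ x, Φ n x * h x) + ∑ i, ∫ x, fderiv ℝ (Φ n) x (basisVec i) * k i x = 0 :=
    fun n => integral_complex_test_eq_zero (hh.locallyIntegrable one_le_two)
      (fun i => (hk i).locallyIntegrable one_le_two) H
      ((hχs.comp (contDiff_const_smul _)).smul (ψ.smooth ⊤))
      ((hχc.comp_smul (hε0 n).ne').smul_right)
  have hψ2 : MemLp ψ 2 volume := ψ.memLp 2 volume
  have hdψ2 : ∀ i, MemLp (fun x => fderiv ℝ ψ x (basisVec i)) 2 volume := fun i =>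
    (LineDeriv.lineDerivOp (basisVec i) ψ).memLp 2 volume
  have hlim : ∀ x : E3, Tendsto (fun n => χ (ε n • x)) atTop (𝓝 1) := fun x => by
    have h1 : Tendsto (fun n => ε n • x) atTop (𝓝 0) := by
      simpa using hεt.smul_const x
    have h2 := (hχs.continuous.tendsto 0).comp h1
    rwa [χ.one_of_mem_closedBall (by simp [χ])] at h2
  have hχb : ∀ y, ‖χ y‖ ≤ 1 := fun y => by
    rw [Real.norm_of_nonneg χ.nonneg]
    exact χ.le_one
  have t0 : Tendsto (fun n => ∫ x, Φ n x * h x) atTop (𝓝 (∫ x, ψ x * h x)) := by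
    refine tendsto_integral_of_dominated_convergence (fun x => ‖ψ x * h x‖) (fun n => ?_)
      (memLp_mul_integrable hψ2 hh).norm (fun n => .of_forall fun x => ?_)
      (.of_forall fun x => ?_)
    · exact ((hχs.continuous.comp (continuous_const_smul _)).smul
        ψ.continuous).aestronglyMeasurable.mul hh.1
    · simp only [Φ, norm_mul, norm_smul]
      gcongr
      exact mul_le_of_le_one_left (norm_nonneg _) (hχb _)
    · have := ((hlim x).smul_const (ψ x)).mul_const (h x)
      simpa only [one_smul] using this
  have t1 : ∀ i, Tendsto (fun n => ∫ x, fderiv ℝ (Φ n) x (basisVec i) * k i x) atTop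
      (𝓝 (∫ x, fderiv ℝ ψ x (basisVec i) * k i x)) := fun i => by
    have hSi : ∀ y, ‖fderiv ℝ χ y (basisVec i)‖ ≤ S := fun y => by
      refine ((fderiv ℝ χ y).le_opNorm _).trans ?_
      simpa using hS y
    refine tendsto_integral_of_dominated_convergence
      (fun x => ‖fderiv ℝ ψ x (basisVec i) * k i x‖ + S * ‖ψ x * k i x‖) (fun n => ?_)
      ((memLp_mul_integrable (hdψ2 i) (hk i)).norm.add
        ((memLp_mul_integrable hψ2 (hk i)).norm.const_mul S)) (fun n => .of_forall fun x => ?_)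
      (.of_forall fun x => ?_)
    · refine AEStronglyMeasurable.mul (Continuous.aestronglyMeasurable ?_) (hk i).1
      refine Continuous.clm_apply ?_ continuous_const
      exact (((hχs.comp (contDiff_const_smul _)).smul (ψ.smooth ⊤)).continuous_fderiv (by simp))
    · rw [hd, add_mul]
      refine (norm_add_le _ _).trans (add_le_add ?_ ?_)
      · simp only [norm_mul, norm_smul]
        gcongr
        exact mul_le_of_le_one_left (norm_nonneg _) (hχb _)
      · simp only [norm_mul, norm_smul]
        rw [← mul_assoc S]
        gcongr
        rw [Real.norm_of_nonneg (hε0 n).le]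
        exact (mul_le_of_le_one_left (norm_nonneg _) (hε1 n)).trans (hSi _)
    · have h2 : Tendsto (fun n => ε n * fderiv ℝ χ (ε n • x) (basisVec i)) atTop (𝓝 0) := by
        refine squeeze_zero_norm (a := fun n => ε n * S) (fun n => ?_) ?_
        · rw [norm_mul, Real.norm_of_nonneg (hε0 n).le]
          exact mul_le_mul_of_nonneg_left (hSi _) (hε0 n).le
        · simpa using hεt.mul_const S
      have h3 := (((hlim x).smul_const (fderiv ℝ ψ x (basisVec i))).add
        (h2.smul_const (ψ x))).mul_const (k i x)
      simpa only [hd, one_smul, zero_smul, add_zero] using h3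
  exact tendsto_nhds_unique (t0.add (tendsto_finsetSum _ fun i _ => t1 i))
    (tendsto_const_nhds.congr fun n => (hz n).symm)

open LineDeriv Laplacian FourierTransform SchwartzMap in
/-- A square integrable distributional eigenfunction of the Laplacian vanishes. -/
theorem ae_eq_zero_of_laplacian_eq {f : E3 → ℂ} (hf : MemLp f 2 volume)
    {g : E3 → EuclideanSpace ℂ (Fin 3)} (hg : MemLp g 2 volume) (hfg : IsWeakGrad f g) (l : ℝ)
    (H : ∀ φ, IsTest φ →
      ∑ i, ∫ x, partialDeriv i φ x • g x i = (l : ℂ) * ∫ x, φ x • f x) :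
    f =ᵐ[volume] 0 := by
  have hgi : ∀ i, MemLp (fun x => g x i) 2 volume := fun i =>
    (EuclideanSpace.proj (𝕜 := ℂ) i).comp_memLp' hg
  have h1 : ∀ (i : Fin 3) (ψ : SchwartzMap E3 ℂ),
      (∫ x, ψ x * g x i) + ∫ x, fderiv ℝ ψ x (basisVec i) * f x = 0 := fun i ψ => by
    -- A field k with the single nonzero component f in direction i recovers the weak derivative
    -- identity in that direction.
    have := integral_schwartz_eq_zero (h := fun x => g x i)
      (k := fun j x => if j = i then f x else 0) (hgi i)
      (fun j => by by_cases hj : j = i <;> simp [hj, hf]) (fun φ hφ => ?_) ψ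
    · rw [Finset.sum_eq_single i (fun j _ hj => by simp [hj]) (by simp)] at this
      simpa only [if_true] using this
    · rw [Finset.sum_eq_single i (fun j _ hj => by simp [hj]) (by simp)]
      simp only [if_true]
      rw [hfg.2.2 i φ hφ]
      exact add_neg_cancel _
  have h2 : ∀ ψ : SchwartzMap E3 ℂ, (∫ x, ψ x * (-(l : ℂ) * f x)) +
      ∑ i, ∫ x, fderiv ℝ ψ x (basisVec i) * g x i = 0 := fun ψ => by
    refine integral_schwartz_eq_zero (hf.const_mul _) hgi (fun φ hφ => ?_) ψ
    rw [H φ hφ, ← integral_const_mul, ← integral_add]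
    · refine integral_eq_zero_of_ae (.of_forall fun x => ?_)
      simp only [Complex.real_smul, Pi.zero_apply]
      ring
    · exact integrable_test_smul hφ.continuous hφ.2
        ((hf.const_mul (-(l : ℂ))).locallyIntegrable one_le_two)
    · exact (integrable_test_smul hφ.continuous hφ.2 hfg.1).const_mul (l : ℂ)
  -- Integrating by parts twice, through g, gives Δf = -l f as tempered distributions.
  have hΔ : Δ (hf.toLp f : TemperedDistribution E3 ℂ) =
      (-(l : ℂ)) • (hf.toLp f : TemperedDistribution E3 ℂ) := by
    ext ψ
    rw [TemperedDistribution.laplacian_apply_apply, Lp.toTemperedDistribution_apply]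
    have hL : ∀ ψ : SchwartzMap E3 ℂ, ∫ x, ψ x • (hf.toLp f) x = ∫ x, ψ x * f x := fun ψ =>
      integral_congr_ae (hf.coeFn_toLp.mono fun x hx => by simp only [hx, smul_eq_mul])
    have hr : ((-(l : ℂ)) • (hf.toLp f : TemperedDistribution E3 ℂ)) ψ =
        -(l : ℂ) * ∫ x, ψ x * f x := by
      rw [← hL, ← Lp.toTemperedDistribution_apply]
      rfl
    rw [hr, hL]
    have h1' : ∀ i : Fin 3, (∫ x, fderiv ℝ ψ x (basisVec i) * g x i) +
        ∫ x, fderiv ℝ (∂_{basisVec i} ψ : SchwartzMap E3 ℂ) x (basisVec i) * f x = 0 :=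
      fun i => h1 i (∂_{basisVec i} ψ)
    have hs : ∀ x, (Δ ψ) x * f x =
        ∑ i, fderiv ℝ (∂_{basisVec i} ψ : SchwartzMap E3 ℂ) x (basisVec i) * f x := fun x => by
      rw [SchwartzMap.laplacian_eq_sum (EuclideanSpace.basisFun (Fin 3) ℝ), sum_apply,
        Finset.sum_mul]
      simp only [EuclideanSpace.basisFun_apply]
      rfl
    simp only [hs]
    rw [integral_finsetSum]
    · have e1 : ∀ i : Fin 3,
          ∫ x, fderiv ℝ (∂_{basisVec i} ψ : SchwartzMap E3 ℂ) x (basisVec i) * f x =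
            - ∫ x, fderiv ℝ ψ x (basisVec i) * g x i := fun i =>
        eq_neg_of_add_eq_zero_right (h1' i)
      have e2 := h2 ψ
      have e3 : ∫ x, ψ x * (-(l : ℂ) * f x) = -(l : ℂ) * ∫ x, ψ x * f x := by
        rw [← integral_const_mul]
        congr 1
        ext x
        ring
      rw [e3] at e2
      simp only [e1, Finset.sum_neg_distrib]
      linear_combination -e2
    · exact fun i _ => memLp_mul_integrable
        ((∂_{basisVec i} (∂_{basisVec i} ψ : SchwartzMap E3 ℂ) : SchwartzMap E3 ℂ).memLp 2 volume) hf
  set w : Lp ℂ 2 (volume : Measure E3) := 𝓕 (hf.toLp f) with hw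
  -- On the Fourier side the Laplacian is multiplication by -(2π)²|ξ|².
  have hF : ((-(2 * Real.pi) ^ 2 : ℝ) : ℂ) • TemperedDistribution.smulLeftCLM ℂ
      (fun x : E3 => Complex.ofReal (‖x‖ ^ 2)) (w : TemperedDistribution E3 ℂ) =
      (-(l : ℂ)) • (w : TemperedDistribution E3 ℂ) := by
    have h := congrArg (fun T : TemperedDistribution E3 ℂ => 𝓕 T) hΔ
    rw [TemperedDistribution.laplacian_eq_fourierMultiplierCLM,
      TemperedDistribution.fourierMultiplierCLM_apply, ← Complex.coe_smul,
      FourierTransform.fourier_smul,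
      FourierTransform.fourier_smul, FourierTransform.fourier_fourierInv_eq,
      Lp.fourier_toTemperedDistribution_eq] at h
    exact h
  have hw0 : ∀ᵐ x, ((l - (2 * Real.pi) ^ 2 * ‖x‖ ^ 2 : ℝ) : ℂ) * w x = 0 := by
    have hwl : LocallyIntegrable w volume := (Lp.memLp w).locallyIntegrable one_le_two
    have hcont : Continuous fun x : E3 => ((l - (2 * Real.pi) ^ 2 * ‖x‖ ^ 2 : ℝ) : ℂ) := by
      fun_prop
    refine ae_eq_zero_of_integral_contDiff_smul_eq_zero
      (hwl.continuous_smul (𝕜 := ℂ) hcont) fun φ hφ hc => ?_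
    have hφ1 : HasCompactSupport (Complex.ofRealCLM ∘ φ) := hc.comp_left rfl
    have hφ2 : ContDiff ℝ ∞ (Complex.ofRealCLM ∘ φ) := by fun_prop
    have h := congrArg (fun T : TemperedDistribution E3 ℂ => T (hφ1.toSchwartzMap hφ2)) hF
    have hr : ((-(2 * Real.pi) ^ 2 : ℝ) : ℂ) * (w : TemperedDistribution E3 ℂ)
        (SchwartzMap.smulLeftCLM ℂ (fun x : E3 => Complex.ofReal (‖x‖ ^ 2))
          (hφ1.toSchwartzMap hφ2)) =
        -(l : ℂ) * (w : TemperedDistribution E3 ℂ) (hφ1.toSchwartzMap hφ2) := h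
    rw [Lp.toTemperedDistribution_apply, Lp.toTemperedDistribution_apply,
      ← integral_const_mul, ← integral_const_mul] at hr
    have i1 : Integrable (fun x => -(l : ℂ) * ((hφ1.toSchwartzMap hφ2) x • w x)) volume :=
      (memLp_mul_integrable ((hφ1.toSchwartzMap hφ2).memLp 2 volume) (Lp.memLp w)).const_mul _
    have i2 : Integrable (fun x => ((-(2 * Real.pi) ^ 2 : ℝ) : ℂ) *
        ((SchwartzMap.smulLeftCLM ℂ (fun x : E3 => Complex.ofReal (‖x‖ ^ 2))
          (hφ1.toSchwartzMap hφ2)) x • w x)) volume :=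
      (memLp_mul_integrable ((SchwartzMap.smulLeftCLM ℂ (fun x : E3 => Complex.ofReal (‖x‖ ^ 2))
          (hφ1.toSchwartzMap hφ2)).memLp 2 volume) (Lp.memLp w)).const_mul _
    rw [← sub_eq_zero, ← integral_sub i2 i1] at hr
    rw [← hr]
    refine integral_congr_ae (.of_forall fun x => ?_)
    simp only
    rw [SchwartzMap.smulLeftCLM_apply_apply (by fun_prop)]
    have hx : (hφ1.toSchwartzMap hφ2) x = (φ x : ℂ) := rfl
    rw [hx]
    simp only [Complex.real_smul, smul_eq_mul]
    push_cast
    ring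
  -- The multiplier vanishes only on a null sphere. If l < 0, the radius defaults to 0, which is
  -- harmless.
  have hsph : ∀ᵐ x : E3, l - (2 * Real.pi) ^ 2 * ‖x‖ ^ 2 ≠ 0 := by
    have hnull := Measure.addHaar_sphere (volume : Measure E3) 0 (√(l / (2 * Real.pi) ^ 2))
    filter_upwards [measure_eq_zero_iff_ae_notMem.1 hnull] with x hx h0
    refine hx ?_
    rw [mem_sphere_zero_iff_norm, ← Real.sqrt_sq (norm_nonneg x)]
    congr 1
    field_simp
    linarith
  have hwz : w = 0 := by
    rw [Lp.eq_zero_iff_ae_eq_zero]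
    filter_upwards [hw0, hsph] with x hx hx'
    exact (mul_eq_zero.1 hx).resolve_left (by exact_mod_cast hx')
  have hz : hf.toLp f = 0 := by
    have h := Lp.norm_fourier_eq (hf.toLp f)
    rw [← hw, hwz, norm_zero] at h
    exact norm_eq_zero.1 h.symm
  exact hf.toLp_eq_toLp_iff MemLp.zero |>.1 (by rw [hz]; rfl)

/-! ### The Gagliardo-Nirenberg inequality and finiteness of the energy -/

/-- A vanishing gradient would make u an L² eigenfunction with eigenvalue 0, hence null. -/
theorem gradSq_pos {u : E3 → ℂ} (hu : MemH1 u) (h0 : ¬ u =ᵐ[volume] 0) : 0 < gradSq u := by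
  refine (gradSq_nonneg u).lt_of_ne fun h => h0 ?_
  have hg := integral_norm_sq_eq_zero hu.memLp_weakGrad h.symm
  refine ae_eq_zero_of_laplacian_eq hu.1 hu.memLp_weakGrad hu.isWeakGrad 0 fun φ _ => ?_
  rw [Complex.ofReal_zero, zero_mul]
  refine Finset.sum_eq_zero fun i _ => integral_eq_zero_of_ae ?_
  filter_upwards [hg] with x hx
  simp [hx]

theorem potential_nonneg (γ p : ℝ) (u : E3 → ℂ) : 0 ≤ potential γ p u := ENNReal.toReal_nonneg

theorem gnQuotient_nonneg (γ p : ℝ) (u : E3 → ℂ) : 0 ≤ gnQuotient γ p u :=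
  div_nonneg (potential_nonneg _ _ _) (by positivity)

theorem potential_congr {γ p : ℝ} {u v : E3 → ℂ} (h : u =ᵐ[volume] v) :
    potential γ p u = potential γ p v := by
  have h1 : ∀ x, rieszPow γ p u x = rieszPow γ p v x := fun x =>
    lintegral_congr_ae (h.mono fun y hy => by simp only [hy])
  rw [potential, potential]
  congr 1
  exact lintegral_congr_ae (h.mono fun y hy => by simp only [hy, h1])

theorem potential_zero {γ p : ℝ} (hp : p ≠ 0) : potential γ p 0 = 0 := by
  simp [potential, Real.zero_rpow hp]

/-- Optimality says that the quotient of Q is the best constant. Null functions are treated apart,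
as the optimizer condition excludes them. -/
theorem IsGroundState.potential_le {γ p : ℝ} (hp : p ≠ 0) {Q : E3 → ℂ}
    (hQ : IsGroundState γ p Q) {v : E3 → ℂ} (hv : MemH1 v) :
    potential γ p v ≤
      gnQuotient γ p Q * (√(mass v) ^ expA γ p * √(gradSq v) ^ expB γ p) := by
  by_cases h0 : v =ᵐ[volume] 0
  · rw [potential_congr h0, potential_zero hp]
    exact mul_nonneg (gnQuotient_nonneg _ _ _) (by positivity)
  · have h := hQ.optimizer v hv h0
    have hm := mass_pos hv h0
    have hg := gradSq_pos hv h0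
    rwa [gnQuotient, div_le_iff₀ (by positivity)] at h

/-- The existence of an optimizer forces the energy to be finite on all of `H¹`. -/
theorem IsGroundState.energy_lt_top {γ p : ℝ} (hγ0 : 0 < γ) (hγ : γ < 3) (hp : 2 ≤ p)
    (hA : 0 ≤ expA γ p) (hB : 0 ≤ expB γ p) {Q : E3 → ℂ} (hQ : IsGroundState γ p Q) {v : E3 → ℂ}
    (hv : MemH1 v) : energy γ (powNorm p v) (powNorm p v) < ⊤ := by
  -- K dominates the energy of every mollification of v. It is real by definition, so finiteness of
  -- the energy of Q is not presupposed.
  set K := gnQuotient γ p Q * (√(mass v) ^ expA γ p * √(gradSq v) ^ expB γ p)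
  refine (energy_le_of_ae_tendsto (K := ENNReal.ofReal K)
    (F := fun n => powNorm p (mollify (bumpSeq n) v)) (fun n => ?_)
    (fun x => ENNReal.ofReal_ne_top) ?_ (fun n => ?_)).trans_lt ENNReal.ofReal_lt_top
  · exact aemeasurable_powNorm (memLp_mollify _ hv.1).1
  · filter_upwards [ae_tendsto_mollify (hv.1.locallyIntegrable one_le_two)] with x hx
    exact ENNReal.tendsto_ofReal (hx.norm.rpow_const (.inr (by linarith)))
  · obtain ⟨h1, hm, hg⟩ := hv.mollify (bumpSeq n)
    obtain ⟨C, hC⟩ := exists_norm_mollify_le (bumpSeq n) hv.1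
    -- The mollification is bounded, so passing from the energy to its `toReal` loses nothing.
    have hfin := energy_powNorm_lt_top_of_bounded hγ0 hγ hp h1.1 hC
    rw [← ENNReal.ofReal_toReal hfin.ne, ← potential_eq h1.1.1]
    refine ENNReal.ofReal_le_ofReal ((hQ.potential_le (by linarith) h1).trans ?_)
    refine mul_le_mul_of_nonneg_left ?_ (gnQuotient_nonneg _ _ _)
    gcongr

/-- Finiteness is essential: an infinite energy would be sent to 0 by `toReal`. -/
theorem potential_pos {γ p : ℝ} (hp : 0 < p) {u : E3 → ℂ} (hu : MemH1 u)
    (hfin : energy γ (powNorm p u) (powNorm p u) < ⊤) (h0 : ¬ u =ᵐ[volume] 0) :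
    0 < potential γ p u := by
  rw [potential_eq hu.1.1]
  refine ENNReal.toReal_pos (fun h => h0 ?_) hfin.ne
  filter_upwards [ae_eq_zero_of_energy_eq_zero (aemeasurable_powNorm hu.1.1) h] with x hx
  have h1 : ‖u x‖ ^ p ≤ 0 := by simpa [powNorm] using hx
  have h2 := h1.antisymm (Real.rpow_nonneg (norm_nonneg _) _)
  rw [Real.rpow_eq_zero (norm_nonneg _) hp.ne'] at h2
  simpa using h2

theorem potential_mono {γ p : ℝ} (hp : 0 ≤ p) {u v : E3 → ℂ} (hu : AEStronglyMeasurable u volume)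
    (hv : AEStronglyMeasurable v volume)
    (hfin : energy γ (powNorm p u) (powNorm p u) < ⊤) (h : ∀ x, ‖v x‖ ≤ ‖u x‖) :
    potential γ p v ≤ potential γ p u := by
  rw [potential_eq hu, potential_eq hv]
  have hle : ∀ x, powNorm p v x ≤ powNorm p u x := fun x =>
    ENNReal.ofReal_le_ofReal (Real.rpow_le_rpow (norm_nonneg _) (h x) hp)
  exact ENNReal.toReal_mono hfin.ne (energy_mono hle hle)

/-! ### Mixed energies -/

/-- A function of finite energy has finite mixed energy with bounded compactly supported ones. -/
theorem energy_lt_top_of_hasCompactSupport {γ : ℝ} (hγ0 : 0 < γ) (hγ : γ < 3)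
    {f g : E3 → ℝ≥0∞} (hf : AEMeasurable f volume) (hg : AEMeasurable g volume)
    (hff : energy γ f f < ⊤) {C : ℝ≥0∞} (hC : C ≠ ⊤) (hgC : ∀ x, g x ≤ C) {ρ : ℝ}
    (hρ : ∀ x, ρ < ‖x‖ → g x = 0) : energy γ f g < ⊤ := by
  by_cases h0 : f =ᵐ[volume] 0
  · rw [energy_eq hf hg, lintegral_congr_ae (g := fun _ => 0) (h0.mono fun x hx => by simp [hx])]
    simp
  rw [energy_eq hf hf] at hff
  have hae := ae_lt_top' (hf.fun_mul (aemeasurable_rieszPot hf)) hff.ne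
  -- Finite self-energy gives one point where the Riesz potential of f is finite. Up to a constant,
  -- the potential of g is dominated by the kernel centred there.
  obtain ⟨x₀, hx₀, hfx₀⟩ : ∃ x, f x * rieszPot γ f x < ⊤ ∧ f x ≠ 0 := by
    by_contra! hcon
    exact h0 (hae.mono fun x hx => hcon x hx)
  have hpot : rieszPot γ f x₀ < ⊤ :=
    (ENNReal.mul_lt_top_iff.1 hx₀).elim (fun h => h.2)
      (fun h => h.elim (fun h => absurd h hfx₀) fun h => h ▸ ENNReal.zero_lt_top)
  have hgi : ∫⁻ x, g x < ⊤ := by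
    have hle : ∀ x, g x ≤ (Metric.closedBall (0 : E3) ρ).indicator (fun _ => C) x := fun x => by
      by_cases hx : x ∈ Metric.closedBall (0 : E3) ρ
      · simpa [hx] using hgC x
      · have : ρ < ‖x‖ := by simpa using hx
        simp [hρ x this]
    refine (lintegral_mono hle).trans_lt ?_
    rw [lintegral_indicator measurableSet_closedBall, setLIntegral_const]
    exact ENNReal.mul_lt_top hC.lt_top measure_closedBall_lt_top
  set Cb := C * (∫⁻ z in Metric.ball (0 : E3) 1, riesz γ z) + ∫⁻ y, g y with hCb
  have hCbt : Cb < ⊤ := ENNReal.add_lt_top.2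
    ⟨ENNReal.mul_lt_top hC.lt_top (lintegral_riesz_unitBall_lt_top hγ0), hgi⟩
  -- If |x₀ - y| > 2L and |z| ≤ ρ, then |x₀ - z| < L, whence |x₀ - y| ≤ 2|y - z|; on |x₀ - y| ≤ 2L
  -- the kernel at x₀ - y is bounded below.
  set L : ℝ := |ρ| + ‖x₀‖ + 1 with hL
  have hLpos : 0 < L := by positivity
  have hscale : ∀ (a : ℝ) (z w : E3), 0 < a → w ≠ 0 → ‖w‖ ≤ a * ‖z‖ →
      riesz γ z ≤ ENNReal.ofReal (a ^ (3 - γ)) * riesz γ w := fun a z w ha hw h => by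
    rw [riesz, riesz, ← ENNReal.ofReal_mul (by positivity)]
    refine ENNReal.ofReal_le_ofReal ?_
    have hw' : 0 < ‖w‖ := norm_pos_iff.2 hw
    have hz' : 0 < ‖z‖ := by
      by_contra! hz
      nlinarith
    have h1 := Real.rpow_le_rpow hw'.le h (by linarith : 0 ≤ 3 - γ)
    rw [Real.mul_rpow ha.le hz'.le] at h1
    have p1 : 0 < ‖w‖ ^ (3 - γ) := by positivity
    have p2 : 0 < ‖z‖ ^ (3 - γ) := by positivity
    rw [inv_eq_one_div, ← div_eq_mul_inv, div_le_div_iff₀ p2 p1]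
    linarith
  set D : ℝ≥0∞ := Cb * ENNReal.ofReal ((2 * L) ^ (3 - γ)) +
    ENNReal.ofReal (2 ^ (3 - γ)) * ∫⁻ y, g y with hD
  have hDt : D < ⊤ := ENNReal.add_lt_top.2 ⟨ENNReal.mul_lt_top hCbt ENNReal.ofReal_lt_top,
    ENNReal.mul_lt_top ENNReal.ofReal_lt_top hgi⟩
  have hbound : ∀ y, y ≠ x₀ → rieszPot γ g y ≤ D * riesz γ (x₀ - y) := fun y hy => by
    have hne : x₀ - y ≠ 0 := sub_ne_zero.2 hy.symm
    rw [hD, add_mul]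
    rcases le_or_gt ‖x₀ - y‖ (2 * L) with hle | hgt
    · refine le_add_right ((rieszPot_le hγ hgC y).trans ?_)
      rw [mul_assoc]
      refine le_mul_of_one_le_right' ?_
      -- A unit vector, where the kernel equals 1, turns the scaling comparison into that lower
      -- bound.
      have e1 : riesz γ (EuclideanSpace.single (0 : Fin 3) (1 : ℝ)) = 1 := by simp [riesz]
      rw [← e1]
      refine hscale _ _ _ (by positivity) hne ?_
      simpa using hle
    · refine le_add_left ?_
      rw [rieszPot, mul_right_comm, mul_comm, ← lintegral_mul_const'' _ hg]
      refine lintegral_mono fun z => ?_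
      by_cases hz : ρ < ‖z‖
      · simp [hρ z hz]
      · refine mul_le_mul_right (hscale 2 _ _ two_pos hne ?_) _
        have h1 : ‖x₀ - y‖ ≤ ‖x₀ - z‖ + ‖y - z‖ := by
          rw [← norm_neg (y - z), neg_sub]
          simpa using norm_add_le (x₀ - z) (z - y)
        have h2 : ‖x₀ - z‖ ≤ ‖x₀‖ + ‖z‖ := norm_sub_le _ _
        have h3 := le_abs_self ρ
        linarith [not_lt.1 hz]
  calc energy γ f g = ∫⁻ y, f y * rieszPot γ g y := energy_eq hf hg
    _ ≤ ∫⁻ y, D * (f y * riesz γ (x₀ - y)) := by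
        refine lintegral_mono_ae ?_
        filter_upwards [measure_eq_zero_iff_ae_notMem.1 (measure_singleton x₀ :
          (volume : Measure E3) {x₀} = 0)] with y hy
        rw [mul_left_comm]
        exact mul_le_mul_right (hbound y hy) _
    _ = D * rieszPot γ f x₀ := lintegral_const_mul'' _ (aemeasurable_rieszPot_integrand hf x₀)
    _ < ⊤ := ENNReal.mul_lt_top hDt hpot

theorem energy_add_lt_top {γ : ℝ} {f g : E3 → ℝ≥0∞} (hf : AEMeasurable f volume)
    (hg : AEMeasurable g volume) (hff : energy γ f f < ⊤) (hfg : energy γ f g < ⊤)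
    (hgg : energy γ g g < ⊤) :
    energy γ (fun x => f x + g x) (fun x => f x + g x) < ⊤ := by
  have hgf : energy γ g f < ⊤ := energy_comm γ f g ▸ hfg
  have h : energy γ (fun x => f x + g x) (fun x => f x + g x) =
      energy γ f f + energy γ f g + (energy γ g f + energy γ g g) := by
    simp only [energy]
    rw [← lintegral_add_left' (aemeasurable_energy_integrand hf hf),
      ← lintegral_add_left' (aemeasurable_energy_integrand hg hf), ← lintegral_add_left']
    · refine lintegral_congr fun z => ?_
      ring
    · exact (aemeasurable_energy_integrand hf hf).add (aemeasurable_energy_integrand hf hg)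
  rw [h]
  exact ENNReal.add_lt_top.2 ⟨ENNReal.add_lt_top.2 ⟨hff, hfg⟩, ENNReal.add_lt_top.2 ⟨hgf, hgg⟩⟩

/-! ### The first variation of the energy -/

/-- The Riesz kernel as a real function. -/
def rieszReal (γ : ℝ) (z : E3) : ℝ := (‖z‖ ^ (3 - γ))⁻¹

theorem rieszReal_nonneg (γ : ℝ) (z : E3) : 0 ≤ rieszReal γ z := by
  unfold rieszReal
  positivity

theorem measurable_rieszReal (γ : ℝ) : Measurable (rieszReal γ) := by
  unfold rieszReal
  fun_prop

theorem riesz_eq (γ : ℝ) (z : E3) : riesz γ z = ENNReal.ofReal (rieszReal γ z) := rfl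

section

variable {F : Type*} [TopologicalSpace F]

theorem aestronglyMeasurable_fst {f : E3 → F} (hf : AEStronglyMeasurable f volume) :
    AEStronglyMeasurable (fun z : E3 × E3 => f z.1) volume :=
  hf.comp_quasiMeasurePreserving Measure.quasiMeasurePreserving_fst

theorem aestronglyMeasurable_snd {f : E3 → F} (hf : AEStronglyMeasurable f volume) :
    AEStronglyMeasurable (fun z : E3 × E3 => f z.2) volume :=
  hf.comp_quasiMeasurePreserving Measure.quasiMeasurePreserving_snd

end

theorem aestronglyMeasurable_rieszReal_sub (γ : ℝ) :
    AEStronglyMeasurable (fun z : E3 × E3 => rieszReal γ (z.1 - z.2)) volume :=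
  ((measurable_rieszReal γ).comp (measurable_fst.sub measurable_snd)).aestronglyMeasurable

theorem aestronglyMeasurable_rpow {f : E3 → ℝ} (hf : AEStronglyMeasurable f volume) (p : ℝ) :
    AEStronglyMeasurable (fun x => f x ^ p) volume :=
  (hf.aemeasurable.pow_const p).aestronglyMeasurable

theorem aestronglyMeasurable_mul_rieszReal (γ : ℝ) {f g : E3 → ℝ}
    (hf : AEStronglyMeasurable f volume) (hg : AEStronglyMeasurable g volume) :
    AEStronglyMeasurable (fun z : E3 × E3 => f z.1 * g z.2 * rieszReal γ (z.1 - z.2)) volume :=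
  ((aestronglyMeasurable_fst hf).mul (aestronglyMeasurable_snd hg)).mul
    (aestronglyMeasurable_rieszReal_sub γ)

theorem potential_eq_integral {γ p : ℝ} {u : E3 → ℂ} (hu : AEStronglyMeasurable u volume) :
    potential γ p u =
      ∫ z : E3 × E3, ‖u z.1‖ ^ p * ‖u z.2‖ ^ p * rieszReal γ (z.1 - z.2) := by
  have hm := aestronglyMeasurable_rpow hu.norm p
  rw [potential_eq hu, integral_eq_lintegral_of_nonneg_ae
    (.of_forall fun z => mul_nonneg (by positivity) (rieszReal_nonneg _ _))
    (aestronglyMeasurable_mul_rieszReal γ hm hm), energy]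
  congr 1
  refine lintegral_congr fun z => ?_
  rw [powNorm, powNorm, riesz_eq, ENNReal.ofReal_mul (by positivity),
    ENNReal.ofReal_mul (by positivity)]

theorem add_rpow_le_two_rpow {p a b : ℝ} (hp : 0 ≤ p) (ha : 0 ≤ a) (hb : 0 ≤ b) :
    (a + b) ^ p ≤ 2 ^ p * (a ^ p + b ^ p) := by
  have h1 : (a + b) ^ p ≤ (2 * max a b) ^ p :=
    Real.rpow_le_rpow (by positivity)
      (by linarith [le_max_left a b, le_max_right a b]) hp
  rw [Real.mul_rpow two_pos.le (by positivity)] at h1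
  refine h1.trans (mul_le_mul_of_nonneg_left ?_ (by positivity))
  have pa : 0 ≤ a ^ p := by positivity
  have pb : 0 ≤ b ^ p := by positivity
  rcases max_choice a b with h | h <;> rw [h] <;> linarith

/-- The dominating function for the first variation is integrable. -/
theorem integrable_energy_dominating {γ p : ℝ} (hγ0 : 0 < γ) (hγ : γ < 3) (hp : 2 ≤ p)
    {Q : E3 → ℂ} (hQ : AEStronglyMeasurable Q volume)
    (hfin : energy γ (powNorm p Q) (powNorm p Q) < ⊤) {φ : E3 → ℝ} (hφ : IsTest φ) (c : ℂ) :
    Integrable (fun z : E3 × E3 => (‖Q z.1‖ + ‖φ z.1 • c‖) ^ p * (‖Q z.2‖ + ‖φ z.2 • c‖) ^ p *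
      rieszReal γ (z.1 - z.2)) volume := by
  set ψ : E3 → ℂ := fun x => φ x • c with hψ
  have hψc : Continuous ψ := hφ.continuous.smul continuous_const
  have hψs : HasCompactSupport ψ := hφ.2.smul_right
  have hψ2 : MemLp ψ 2 volume := hφ.memLp_smul c
  obtain ⟨C, hC⟩ := hψs.exists_bound_of_continuous hψc
  obtain ⟨ρ, hρ⟩ := hψs.isCompact.isBounded.subset_closedBall 0
  have hfQ := aemeasurable_powNorm (p := p) hQ
  have hfψ := aemeasurable_powNorm (p := p) hψ2.1
  have hmix : energy γ (powNorm p Q) (powNorm p ψ) < ⊤ := by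
    refine energy_lt_top_of_hasCompactSupport hγ0 hγ hfQ hfψ hfin
      (C := ENNReal.ofReal (C ^ p)) ENNReal.ofReal_ne_top (fun x => ENNReal.ofReal_le_ofReal
        (Real.rpow_le_rpow (norm_nonneg _) (hC x) (by linarith))) (ρ := ρ) fun x hx => ?_
    have : ψ x = 0 := by
      by_contra h
      have := hρ (subset_tsupport _ h)
      rw [mem_closedBall_zero_iff] at this
      linarith
    simp [powNorm, this, Real.zero_rpow (by linarith : p ≠ 0)]
  have hsum := energy_add_lt_top hfQ hfψ hfin hmix
    (energy_powNorm_lt_top_of_bounded hγ0 hγ hp hψ2 hC)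
  have hm := aestronglyMeasurable_rpow (hQ.norm.add hψ2.1.norm) p
  have hi : Integrable (fun z : E3 × E3 => (2 ^ p * 2 ^ p) * ((‖Q z.1‖ ^ p + ‖ψ z.1‖ ^ p) *
      (‖Q z.2‖ ^ p + ‖ψ z.2‖ ^ p) * rieszReal γ (z.1 - z.2))) volume := by
    refine Integrable.const_mul ⟨?_, ?_⟩ _
    · have hm' := (aestronglyMeasurable_rpow hQ.norm p).add
        (aestronglyMeasurable_rpow hψ2.1.norm p)
      exact aestronglyMeasurable_mul_rieszReal γ hm' hm'
    · rw [hasFiniteIntegral_iff_ofReal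
        (.of_forall fun z => mul_nonneg (by positivity) (rieszReal_nonneg _ _))]
      rw [energy] at hsum
      convert hsum using 3 with z
      simp only [powNorm, riesz_eq]
      rw [ENNReal.ofReal_mul (by positivity),
        ENNReal.ofReal_mul (by positivity), ENNReal.ofReal_add (by positivity) (by positivity),
        ENNReal.ofReal_add (by positivity) (by positivity)]
  refine hi.mono' (aestronglyMeasurable_mul_rieszReal γ hm hm) (.of_forall fun z => ?_)
  rw [Real.norm_of_nonneg (mul_nonneg (by positivity) (rieszReal_nonneg _ _)), ← mul_assoc]
  refine mul_le_mul_of_nonneg_right ?_ (rieszReal_nonneg _ _)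
  calc _ ≤ (2 ^ p * (‖Q z.1‖ ^ p + ‖ψ z.1‖ ^ p)) * (2 ^ p * (‖Q z.2‖ ^ p + ‖ψ z.2‖ ^ p)) :=
        mul_le_mul (add_rpow_le_two_rpow (by linarith) (norm_nonneg _) (norm_nonneg _))
          (add_rpow_le_two_rpow (by linarith) (norm_nonneg _) (norm_nonneg _))
          (by positivity) (by positivity)
    _ = _ := by ring

theorem hasDerivAt_norm_add_smul_rpow {p : ℝ} (hp : 1 < p) (a b : ℂ) (t : ℝ) :
    HasDerivAt (fun t : ℝ => ‖a + t • b‖ ^ p)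
      (p * ‖a + t • b‖ ^ (p - 2) * inner ℝ (a + t • b) b) t := by
  have h1 : HasDerivAt (fun t : ℝ => a + t • b) b t := by
    simpa using ((hasDerivAt_id t).smul_const b).const_add a
  have h2 := (hasFDerivAt_norm_rpow (a + t • b) hp).comp_hasDerivAt t h1
  exact h2

/-- Applied with a = Q + tφc, b = φc and S = |Q| + |φc|, this gives a bound uniform in |t| ≤ 1 for
differentiating under the integral. -/
theorem abs_deriv_norm_rpow_le {p : ℝ} (hp : 2 ≤ p) {a b : ℂ} {S : ℝ} (ha : ‖a‖ ≤ S)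
    (hb : ‖b‖ ≤ S) : |p * ‖a‖ ^ (p - 2) * inner ℝ a b| ≤ p * S ^ p := by
  have hS : 0 ≤ S := (norm_nonneg a).trans ha
  have e : S ^ p = S ^ (p - 2) * (S * S) := by
    rw [← sq, ← Real.rpow_natCast S 2, ← Real.rpow_add_of_nonneg hS (by linarith) (by simp)]
    simp
  rw [abs_mul, abs_of_nonneg (by positivity : 0 ≤ p * ‖a‖ ^ (p - 2)), e, ← mul_assoc]
  have h1 : |inner ℝ a b| ≤ S * S :=
    (abs_real_inner_le_norm a b).trans (mul_le_mul ha hb (norm_nonneg _) hS)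
  have h2 : ‖a‖ ^ (p - 2) ≤ S ^ (p - 2) := Real.rpow_le_rpow (norm_nonneg _) ha (by linarith)
  gcongr

/-- The weak nonlinearity tested against `φ`. -/
def nonlinPairing (γ p : ℝ) (Q : E3 → ℂ) (φ : E3 → ℝ) : ℂ :=
  ∫ x, φ x • (((rieszPow γ p Q x).toReal * ‖Q x‖ ^ (p - 2)) • Q x)

/-- The nonlinearity before integrating out the second variable. -/
def nonlinKernel (γ p : ℝ) (Q : E3 → ℂ) (φ : E3 → ℝ) (z : E3 × E3) : ℂ :=
  (φ z.1 * ‖Q z.1‖ ^ (p - 2) * ‖Q z.2‖ ^ p * rieszReal γ (z.1 - z.2)) • Q z.1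

theorem integrable_nonlinKernel {γ p : ℝ} (hγ0 : 0 < γ) (hγ : γ < 3) (hp : 2 ≤ p)
    {Q : E3 → ℂ} (hQ : AEStronglyMeasurable Q volume)
    (hfin : energy γ (powNorm p Q) (powNorm p Q) < ⊤) {φ : E3 → ℝ} (hφ : IsTest φ) :
    Integrable (nonlinKernel γ p Q φ) volume := by
  refine (integrable_energy_dominating hγ0 hγ hp hQ hfin hφ 1).mono' ?_ (.of_forall fun z => ?_)
  · exact ((((aestronglyMeasurable_fst hφ.continuous.aestronglyMeasurable).mul
      (aestronglyMeasurable_fst (aestronglyMeasurable_rpow hQ.norm (p - 2)))).mul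
      (aestronglyMeasurable_snd (aestronglyMeasurable_rpow hQ.norm p))).mul
      (aestronglyMeasurable_rieszReal_sub γ)).smul (aestronglyMeasurable_fst hQ)
  · set S := ‖Q z.1‖ + ‖φ z.1 • (1 : ℂ)‖ with hS
    have hS0 : 0 ≤ S := by positivity
    have e : S ^ p = S * S ^ (p - 2) * S := by
      rw [mul_right_comm, ← sq, ← Real.rpow_natCast S 2,
        ← Real.rpow_add_of_nonneg hS0 (by simp) (by linarith)]
      simp
    have hφ1 : ‖φ z.1‖ = ‖φ z.1 • (1 : ℂ)‖ := by simp
    rw [nonlinKernel, norm_smul, norm_mul, norm_mul, norm_mul,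
      Real.norm_of_nonneg (rieszReal_nonneg _ _), Real.norm_of_nonneg (by positivity :
        0 ≤ ‖Q z.1‖ ^ (p - 2)), Real.norm_of_nonneg (by positivity : 0 ≤ ‖Q z.2‖ ^ p), hφ1]
    -- The factor |φ||Q|^(p-1) is absorbed into (|Q| + |φ|)^p, the dominating function with c = 1.
    have h1 : ‖φ z.1 • (1 : ℂ)‖ * ‖Q z.1‖ ^ (p - 2) * ‖Q z.1‖ ≤ S ^ p := by
      rw [e]
      have : ‖φ z.1 • (1 : ℂ)‖ ≤ S := le_add_of_nonneg_left (norm_nonneg _)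
      have : ‖Q z.1‖ ≤ S := le_add_of_nonneg_right (norm_nonneg _)
      have : ‖Q z.1‖ ^ (p - 2) ≤ S ^ (p - 2) :=
        Real.rpow_le_rpow (norm_nonneg _) this (by linarith)
      gcongr
    have h2 : ‖Q z.2‖ ^ p ≤ (‖Q z.2‖ + ‖φ z.2 • (1 : ℂ)‖) ^ p :=
      Real.rpow_le_rpow (norm_nonneg _) (le_add_of_nonneg_right (norm_nonneg _)) (by linarith)
    calc _ = (‖φ z.1 • (1 : ℂ)‖ * ‖Q z.1‖ ^ (p - 2) * ‖Q z.1‖) * ‖Q z.2‖ ^ p *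
          rieszReal γ (z.1 - z.2) := by ring
      _ ≤ _ := mul_le_mul_of_nonneg_right (mul_le_mul h1 h2 (by positivity) (by positivity))
        (rieszReal_nonneg _ _)

theorem integral_nonlinKernel {γ p : ℝ} (hγ0 : 0 < γ) (hγ : γ < 3) (hp : 2 ≤ p)
    {Q : E3 → ℂ} (hQ : AEStronglyMeasurable Q volume)
    (hfin : energy γ (powNorm p Q) (powNorm p Q) < ⊤) {φ : E3 → ℝ} (hφ : IsTest φ) :
    ∫ z, nonlinKernel γ p Q φ z = nonlinPairing γ p Q φ := by
  rw [Measure.volume_eq_prod, integral_prod _ (integrable_nonlinKernel hγ0 hγ hp hQ hfin hφ),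
    nonlinPairing]
  refine integral_congr_ae (.of_forall fun x => ?_)
  have hR : (rieszPow γ p Q x).toReal = ∫ y, ‖Q y‖ ^ p * rieszReal γ (x - y) := by
    rw [integral_eq_lintegral_of_nonneg_ae
      (.of_forall fun z => mul_nonneg (by positivity) (rieszReal_nonneg _ _))]
    · congr 1
    · exact (aestronglyMeasurable_rpow hQ.norm p).mul ((measurable_rieszReal γ).comp
        (measurable_const.sub measurable_id)).aestronglyMeasurable
  simp only [nonlinKernel, hR]
  rw [integral_smul_const, smul_smul, ← mul_assoc]
  congr 1
  rw [mul_right_comm, ← integral_const_mul]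
  refine integral_congr_ae (.of_forall fun y => ?_)
  ring

/-- The first variation of the potential energy. -/
theorem hasDerivAt_potential {γ p : ℝ} (hγ0 : 0 < γ) (hγ : γ < 3) (hp : 2 ≤ p)
    {Q : E3 → ℂ} (hQ : AEStronglyMeasurable Q volume)
    (hfin : energy γ (powNorm p Q) (powNorm p Q) < ⊤) {φ : E3 → ℝ} (hφ : IsTest φ) (c : ℂ) :
    HasDerivAt (fun t : ℝ => potential γ p fun x => Q x + t • φ x • c)
      (2 * p * inner ℝ (nonlinPairing γ p Q φ) c) 0 := by
  have hψ : AEStronglyMeasurable (fun x => φ x • c) volume := (hφ.memLp_smul c).1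
  have hm : ∀ t : ℝ, AEStronglyMeasurable (fun x => Q x + t • φ x • c) volume := fun t =>
    hQ.add (hψ.const_smul t)
  simp only [fun t => potential_eq_integral (γ := γ) (p := p) (hm t)]
  let N : ℝ → E3 → ℝ := fun t x => ‖Q x + t • φ x • c‖ ^ p
  let D : ℝ → E3 → ℝ := fun t x =>
    p * ‖Q x + t • φ x • c‖ ^ (p - 2) * inner ℝ (Q x + t • φ x • c) (φ x • c)
  have hND : ∀ t x, HasDerivAt (fun t => N t x) (D t x) t := fun t x =>
    hasDerivAt_norm_add_smul_rpow (by linarith) (Q x) (φ x • c) t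
  have hNm : ∀ t, AEStronglyMeasurable (N t) volume := fun t =>
    aestronglyMeasurable_rpow (hm t).norm p
  have hdom := integrable_energy_dominating hγ0 hγ hp hQ hfin hφ c
  set S : E3 → ℝ := fun x => ‖Q x‖ + ‖φ x • c‖ with hS
  have hle : ∀ t : ℝ, |t| ≤ 1 → ∀ x, ‖Q x + t • φ x • c‖ ≤ S x := fun t ht x => by
    refine (norm_add_le _ _).trans (add_le_add_right ?_ _)
    rw [norm_smul, Real.norm_eq_abs]
    exact mul_le_of_le_one_left (norm_nonneg _) ht
  have hNle : ∀ t : ℝ, |t| ≤ 1 → ∀ x, |N t x| ≤ S x ^ p := fun t ht x => by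
    rw [abs_of_nonneg (by positivity)]
    exact Real.rpow_le_rpow (norm_nonneg _) (hle t ht x) (by linarith)
  have hDle : ∀ t : ℝ, |t| ≤ 1 → ∀ x, |D t x| ≤ p * S x ^ p := fun t ht x =>
    abs_deriv_norm_rpow_le hp (hle t ht x) (le_add_of_nonneg_left (norm_nonneg _))
  have hκs : ∀ z : E3 × E3, rieszReal γ (z.1 - z.2) = rieszReal γ (z.2 - z.1) := fun z => by
    rw [rieszReal, rieszReal, norm_sub_rev]
  have hDi : ∀ t : ℝ, |t| ≤ 1 → ∀ z : E3 × E3,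
      ‖D t z.1 * N t z.2 * rieszReal γ (z.1 - z.2)‖ ≤
        p * (S z.1 ^ p * S z.2 ^ p * rieszReal γ (z.1 - z.2)) := fun t ht z => by
    rw [norm_mul, norm_mul, Real.norm_of_nonneg (rieszReal_nonneg _ _), ← mul_assoc, ← mul_assoc]
    exact mul_le_mul_of_nonneg_right (mul_le_mul (hDle t ht _) (hNle t ht _) (abs_nonneg _)
      (by positivity)) (rieszReal_nonneg _ _)
  have hDi' : ∀ t : ℝ, |t| ≤ 1 → ∀ z : E3 × E3,
      ‖N t z.1 * D t z.2 * rieszReal γ (z.1 - z.2)‖ ≤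
        p * (S z.1 ^ p * S z.2 ^ p * rieszReal γ (z.1 - z.2)) := fun t ht z => by
    have h := hDi t ht z.swap
    simp only [Prod.fst_swap, Prod.snd_swap] at h
    rwa [hκs z, mul_comm (N t z.1), mul_comm (S z.1 ^ p)]
  have hN0 : ∀ x, N 0 x = ‖Q x‖ ^ p := fun x => by simp [N]
  have hD0 : ∀ z : E3 × E3, D 0 z.1 * N 0 z.2 * rieszReal γ (z.1 - z.2) =
      p * inner ℝ (nonlinKernel γ p Q φ z) c := fun z => by
    rw [hN0, nonlinKernel, real_inner_smul_left]
    simp only [D, zero_smul, add_zero, real_inner_smul_right]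
    ring
  have hi : Integrable (fun z => p * inner ℝ (nonlinKernel γ p Q φ z) c) volume :=
    ((integrable_nonlinKernel hγ0 hγ hp hQ hfin hφ).inner_const c).const_mul p
  have hi1 : Integrable (fun z : E3 × E3 => D 0 z.1 * N 0 z.2 * rieszReal γ (z.1 - z.2))
      volume := by
    simpa only [hD0] using hi
  -- The kernel is symmetric, so swapping variables identifies the two product-rule terms; this is
  -- the 2 in the derivative.
  have hsw : ∀ z : E3 × E3, N 0 z.1 * D 0 z.2 * rieszReal γ (z.1 - z.2) =
      D 0 z.swap.1 * N 0 z.swap.2 * rieszReal γ (z.swap.1 - z.swap.2) := fun z => by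
    rw [hκs z, mul_comm (N 0 z.1)]
    rfl
  have hi2 : Integrable (fun z : E3 × E3 => N 0 z.1 * D 0 z.2 * rieszReal γ (z.1 - z.2))
      volume := by
    simp only [hsw]
    exact hi1.swap
  have e1 : ∫ z : E3 × E3, D 0 z.1 * N 0 z.2 * rieszReal γ (z.1 - z.2) =
      p * inner ℝ (nonlinPairing γ p Q φ) c := by
    simp only [hD0]
    rw [integral_const_mul, ← integral_nonlinKernel hγ0 hγ hp hQ hfin hφ]
    congr 1
    simp only [real_inner_comm c]
    exact integral_inner (integrable_nonlinKernel hγ0 hγ hp hQ hfin hφ) c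
  have e2 : ∫ z : E3 × E3, N 0 z.1 * D 0 z.2 * rieszReal γ (z.1 - z.2) =
      p * inner ℝ (nonlinPairing γ p Q φ) c := by
    simp only [hsw]
    rw [← e1]
    exact integral_prod_swap (μ := (volume : Measure E3)) (ν := (volume : Measure E3))
      fun z : E3 × E3 => D 0 z.1 * N 0 z.2 * rieszReal γ (z.1 - z.2)
  have hmem : ∀ t ∈ Metric.ball (0 : ℝ) 1, |t| ≤ 1 := fun t ht => by
    simpa using (mem_ball_zero_iff.1 ht).le
  have key := hasDerivAt_integral_of_dominated_loc_of_deriv_le (μ := (volume : Measure (E3 × E3)))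
    (F := fun t z => N t z.1 * N t z.2 * rieszReal γ (z.1 - z.2))
    (F' := fun t z => D t z.1 * N t z.2 * rieszReal γ (z.1 - z.2) +
      N t z.1 * D t z.2 * rieszReal γ (z.1 - z.2))
    (bound := fun z => p * (S z.1 ^ p * S z.2 ^ p * rieszReal γ (z.1 - z.2)) +
      p * (S z.1 ^ p * S z.2 ^ p * rieszReal γ (z.1 - z.2)))
    (x₀ := (0 : ℝ)) (s := Metric.ball 0 1) (Metric.ball_mem_nhds _ one_pos)
    (.of_forall fun t => aestronglyMeasurable_mul_rieszReal γ (hNm t) (hNm t)) ?_ (hi1.add hi2).1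
    (.of_forall fun z t ht => (norm_add_le _ _).trans
      (add_le_add (hDi t (hmem t ht) z) (hDi' t (hmem t ht) z)))
    ((hdom.const_mul p).add (hdom.const_mul p)) (.of_forall fun z t _ => ?_)
  · have hfinal := key.2
    rw [integral_add hi1 hi2, e1, e2] at hfinal
    exact hfinal.congr_deriv (by ring)
  · refine hdom.mono' (aestronglyMeasurable_mul_rieszReal γ (hNm 0) (hNm 0))
      (.of_forall fun z => ?_)
    rw [norm_mul, norm_mul, Real.norm_of_nonneg (rieszReal_nonneg _ _)]
    exact mul_le_mul_of_nonneg_right (mul_le_mul (hNle 0 (by simp) _) (hNle 0 (by simp) _)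
      (abs_nonneg _) (by positivity)) (rieszReal_nonneg _ _)
  · have h := ((hND t z.1).mul (hND t z.2)).mul_const (rieszReal γ (z.1 - z.2))
    exact h.congr_deriv (by ring)

/-! ### The Euler-Lagrange equation and the Pohozaev identity -/

theorem hasDerivAt_integral_norm_sq {V : Type*} [NormedAddCommGroup V] [InnerProductSpace ℝ V]
    {a b : E3 → V} (ha : MemLp a 2 volume) (hb : MemLp b 2 volume) :
    HasDerivAt (fun t : ℝ => ∫ x, ‖a x + t • b x‖ ^ 2) (2 * ∫ x, inner ℝ (a x) (b x)) 0 := by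
  have hab : Integrable (fun x => inner ℝ (a x) (b x)) volume := by
    refine ((integrable_norm_sq ha).add (integrable_norm_sq hb)).mono' (ha.1.inner hb.1)
      (.of_forall fun x => ?_)
    have h1 := abs_real_inner_le_norm (a x) (b x)
    rw [Real.norm_eq_abs]
    change _ ≤ ‖a x‖ ^ 2 + ‖b x‖ ^ 2
    nlinarith [sq_nonneg (‖a x‖ - ‖b x‖), sq_nonneg (‖a x‖), sq_nonneg (‖b x‖)]
  have hab' : ∀ t : ℝ, Integrable (fun x => ‖a x‖ ^ 2 + t * (2 * inner ℝ (a x) (b x))) volume :=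
    fun t => (integrable_norm_sq ha).add ((hab.const_mul 2).const_mul t)
  have h : ∀ t : ℝ, ∫ x, ‖a x + t • b x‖ ^ 2 =
      ((∫ x, ‖a x‖ ^ 2) + t * (2 * ∫ x, inner ℝ (a x) (b x))) + t ^ 2 * ∫ x, ‖b x‖ ^ 2 :=
    fun t => by
      rw [← integral_const_mul, ← integral_const_mul, ← integral_const_mul,
        ← integral_add (integrable_norm_sq ha) ((hab.const_mul 2).const_mul t),
        ← integral_add (hab' t) ((integrable_norm_sq hb).const_mul _)]
      refine integral_congr_ae (.of_forall fun x => ?_)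
      simp only [norm_add_sq_real, real_inner_smul_right, norm_smul, mul_pow, Real.norm_eq_abs,
        sq_abs]
      ring
  simp only [h]
  have h1 := ((hasDerivAt_id (0 : ℝ)).mul_const (2 * ∫ x, inner ℝ (a x) (b x))).const_add
    (∫ x, ‖a x‖ ^ 2)
  have h2 := h1.add ((hasDerivAt_pow 2 (0 : ℝ)).mul_const (∫ x, ‖b x‖ ^ 2))
  exact h2.congr_deriv (by simp)

/-- `∫ φ u`. -/
def massPairing (u : E3 → ℂ) (φ : E3 → ℝ) : ℂ := ∫ x, φ x • u x

/-- `∫ ∇φ · ∇u`. -/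
def gradPairing (u : E3 → ℂ) (φ : E3 → ℝ) : ℂ :=
  ∑ i : Fin 3, ∫ x, partialDeriv i φ x • weakGrad u x i

theorem isWeakGrad_add_smul {u : E3 → ℂ} (hu : MemH1 u) {φ : E3 → ℝ} (hφ : IsTest φ) (c : ℂ)
    (t : ℝ) : IsWeakGrad (fun x => u x + t • φ x • c)
      fun x => weakGrad u x + t • c • cgrad φ x := by
  have h := hu.isWeakGrad.add (hφ.isWeakGrad_smul (t • c))
  simpa only [smul_comm _ t c, smul_assoc, smul_comm (φ _) t] using h

theorem MemH1.add_smul_test {u : E3 → ℂ} (hu : MemH1 u) {φ : E3 → ℝ} (hφ : IsTest φ) (c : ℂ)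
    (t : ℝ) : MemH1 fun x => u x + t • φ x • c :=
  ⟨hu.1.add ((hφ.memLp_smul c).const_smul t), _, isWeakGrad_add_smul hu hφ c t,
    hu.memLp_weakGrad.add ((hφ.memLp_cgrad c).const_smul t)⟩

theorem hasDerivAt_mass {u : E3 → ℂ} (hu : MemH1 u) {φ : E3 → ℝ} (hφ : IsTest φ) (c : ℂ) :
    HasDerivAt (fun t : ℝ => mass fun x => u x + t • φ x • c)
      (2 * inner ℝ (massPairing u φ) c) 0 := by
  refine (hasDerivAt_integral_norm_sq hu.1 (hφ.memLp_smul c)).congr_deriv ?_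
  congr 1
  rw [massPairing, real_inner_comm, ← integral_inner
    (integrable_test_smul hφ.continuous hφ.2 (hu.1.locallyIntegrable one_le_two)) c]
  refine integral_congr_ae (.of_forall fun x => ?_)
  simp only [real_inner_smul_right, real_inner_comm]

theorem hasDerivAt_gradSq {u : E3 → ℂ} (hu : MemH1 u) {φ : E3 → ℝ} (hφ : IsTest φ) (c : ℂ) :
    HasDerivAt (fun t : ℝ => gradSq fun x => u x + t • φ x • c)
      (2 * inner ℝ (gradPairing u φ) c) 0 := by
  simp only [fun t => (isWeakGrad_add_smul hu hφ c t).gradSq_eq]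
  refine (hasDerivAt_integral_norm_sq hu.memLp_weakGrad (hφ.memLp_cgrad c)).congr_deriv ?_
  congr 1
  have hi : ∀ i, Integrable (fun x => partialDeriv i φ x • weakGrad u x i) volume := fun i =>
    integrable_test_smul (hφ.continuous_partialDeriv i) (hφ.hasCompactSupport_partialDeriv i)
      (locallyIntegrable_comp hu.isWeakGrad.2.1 i)
  rw [gradPairing, sum_inner]
  have e : ∀ i, inner ℝ (∫ x, partialDeriv i φ x • weakGrad u x i) c =
      ∫ x, inner ℝ c (partialDeriv i φ x • weakGrad u x i) := fun i => by
    rw [real_inner_comm, integral_inner (hi i) c]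
  simp only [e]
  rw [← integral_finsetSum _ fun i _ => (hi i).const_inner c]
  refine integral_congr_ae (.of_forall fun x => ?_)
  simp only [PiLp.inner_apply]
  refine Finset.sum_congr rfl fun i _ => ?_
  have : (c • cgrad φ x) i = partialDeriv i φ x • c := by simp [mul_comm]
  rw [this, real_inner_smul_right, real_inner_smul_right, real_inner_comm]

/-- The difference between the two sides of the sharp inequality is nonnegative along Q + tφc and
vanishes at t = 0, so its derivative there is zero. -/
theorem IsGroundState.euler_lagrange {γ p : ℝ} (hγ0 : 0 < γ) (hγ : γ < 3) (hp : 2 ≤ p)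
    (hA : 0 ≤ expA γ p) (hB : 0 ≤ expB γ p) {Q : E3 → ℂ} (hQ : IsGroundState γ p Q)
    {φ : E3 → ℝ} (hφ : IsTest φ) (c : ℂ) :
    potential γ p Q * (expA γ p * inner ℝ (massPairing Q φ) c / mass Q +
      expB γ p * inner ℝ (gradPairing Q φ) c / gradSq Q) =
      2 * p * inner ℝ (nonlinPairing γ p Q φ) c := by
  have hfin := hQ.energy_lt_top hγ0 hγ hp hA hB hQ.memH1
  have hM := mass_pos hQ.memH1 hQ.ne_zero
  have hG := gradSq_pos hQ.memH1 hQ.ne_zero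
  have h0 : (fun x => Q x + (0 : ℝ) • φ x • c) = Q := by
    ext x
    simp
  have dP := hasDerivAt_potential hγ0 hγ hp hQ.memH1.1.1 hfin hφ c
  have dM := hasDerivAt_mass hQ.memH1 hφ c
  have dG := hasDerivAt_gradSq hQ.memH1 hφ c
  have dM' := (dM.sqrt (by rw [h0]; exact hM.ne')).rpow_const (p := expA γ p)
    (.inl (by rw [h0]; exact (Real.sqrt_pos.2 hM).ne'))
  have dG' := (dG.sqrt (by rw [h0]; exact hG.ne')).rpow_const (p := expB γ p)
    (.inl (by rw [h0]; exact (Real.sqrt_pos.2 hG).ne'))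
  have dR := ((dM'.mul dG').const_mul (gnQuotient γ p Q)).sub dP
  have hmin : IsLocalMin ((fun t : ℝ => gnQuotient γ p Q *
      (√(mass fun x => Q x + t • φ x • c) ^ expA γ p *
        √(gradSq fun x => Q x + t • φ x • c) ^ expB γ p)) -
      fun t : ℝ => potential γ p fun x => Q x + t • φ x • c) 0 := by
    refine .of_forall fun t => ?_
    have h := hQ.potential_le (by linarith) (hQ.memH1.add_smul_test hφ c t)
    simp only [Pi.sub_apply, h0]
    have e : gnQuotient γ p Q * (√(mass Q) ^ expA γ p * √(gradSq Q) ^ expB γ p) =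
        potential γ p Q := div_mul_cancel₀ _ (by positivity)
    rw [e, sub_self]
    linarith
  have hz := hmin.hasDerivAt_eq_zero dR
  rw [h0] at hz
  have hs := Real.sqrt_pos.2 hM
  have hr := Real.sqrt_pos.2 hG
  -- Writing s^(A-1) = s^A / s lets the powers be treated as atoms, so the rest is field algebra.
  rw [gnQuotient, Real.rpow_sub_one hs.ne', Real.rpow_sub_one hr.ne'] at hz
  have hM2 : mass Q = √(mass Q) ^ 2 := (Real.sq_sqrt hM.le).symm
  have hG2 : gradSq Q = √(gradSq Q) ^ 2 := (Real.sq_sqrt hG.le).symm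
  have pa : 0 < √(mass Q) ^ expA γ p := by positivity
  have pb : 0 < √(gradSq Q) ^ expB γ p := by positivity
  generalize √(mass Q) = s at *
  generalize √(gradSq Q) = r at *
  rw [hM2, hG2]
  generalize s ^ expA γ p = α at *
  generalize r ^ expB γ p = β at *
  rw [← sub_eq_zero, ← hz]
  field_simp

/-- The Pohozaev identity for ground states. -/
theorem IsGroundState.gradSq_eq {γ p : ℝ} (hγ0 : 0 < γ) (hγ : γ < 3) (hp : 2 ≤ p)
    (hA : 0 ≤ expA γ p) (hB : 0 ≤ expB γ p) {Q : E3 → ℂ} (hQ : IsGroundState γ p Q) :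
    gradSq Q = expB γ p / (2 * p) * potential γ p Q := by
  have hM := mass_pos hQ.memH1 hQ.ne_zero
  have hG := gradSq_pos hQ.memH1 hQ.ne_zero
  by_contra hne
  set P := potential γ p Q with hP
  -- These are the coefficients of the mass and gradient pairings left after eliminating the
  -- nonlinearity; b = 0 is the claim.
  set a : ℝ := P * expA γ p / mass Q - 2 * p with ha
  set b : ℝ := P * expB γ p / gradSq Q - 2 * p with hb
  have hb0 : b ≠ 0 := fun h => hne (by
    rw [hb, sub_eq_zero, div_eq_iff hG.ne'] at h
    field_simp
    linarith)
  have key : ∀ φ, IsTest φ → a • massPairing Q φ + b • gradPairing Q φ = 0 := fun φ hφ => by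
    have hN : nonlinPairing γ p Q φ = massPairing Q φ + gradPairing Q φ := by
      have h : -massPairing Q φ - gradPairing Q φ + nonlinPairing γ p Q φ = 0 := hQ.solves φ hφ
      linear_combination h
    -- The variation gives real inner products with c; letting c range over ℂ recovers the complex
    -- identity.
    refine ext_inner_right ℝ fun c => ?_
    have h := hQ.euler_lagrange hγ0 hγ hp hA hB hφ c
    rw [hN, inner_add_left] at h
    rw [inner_add_left, real_inner_smul_left, real_inner_smul_left, inner_zero_left, ha, hb]
    rw [← hP] at h
    linear_combination h
  refine hQ.ne_zero (ae_eq_zero_of_laplacian_eq hQ.memH1.1 hQ.memH1.memLp_weakGrad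
    hQ.memH1.isWeakGrad (-a / b) fun φ hφ => ?_)
  have h := key φ hφ
  change gradPairing Q φ = _ * massPairing Q φ
  simp only [Complex.real_smul] at h
  have hb' : (b : ℂ) ≠ 0 := by exact_mod_cast hb0
  push_cast
  field_simp
  linear_combination h

/-! ### Coercivity below the ground state -/

/-- With A + B = 2p, one has s_c = (B-2)/(2(p-1)) and 1 - s_c = A/(2(p-1)). In this form σ_c visibly
matches the Gagliardo–Nirenberg exponents. -/
theorem sigmaCrit_eq {γ p : ℝ} (hp : 1 < p) (hB : 2 < expB γ p) :
    sigmaCrit γ p = expA γ p / (expB γ p - 2) := by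
  have h1 : p - 1 ≠ 0 := by linarith
  have h2 : expB γ p - 2 ≠ 0 := by linarith
  have hs : sCrit γ p = (expB γ p - 2) / (2 * (p - 1)) := by
    rw [sCrit, expB]
    field_simp
    ring
  rw [sigmaCrit, hs]
  field_simp
  rw [expA, expB]
  ring

/-- The elementary inequality behind coercivity. -/
theorem le_rpow_mul_of_gn {a b x m g θ : ℝ} (hb : 2 < b) (hx : 0 < x)
    (hm : 0 < m) (hg : 0 ≤ g) (h : x ≤ m ^ (a / 2) * g ^ (b / 2))
    (hθ : x * m ^ (a / (b - 2)) ≤ θ) : x ≤ θ ^ ((b - 2) / b) * g := by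
  have hb2 : 0 < b - 2 := by linarith
  have hθ0 : 0 < θ := lt_of_lt_of_le (by positivity) hθ
  -- The power (b-2)/2 turns m^(a/(b-2)) into m^(a/2), the factor appearing in Gagliardo–Nirenberg.
  have e1 : x ^ ((b - 2) / 2) * m ^ (a / 2) ≤ θ ^ ((b - 2) / 2) := by
    have h1 := Real.rpow_le_rpow (by positivity) hθ (by positivity : 0 ≤ (b - 2) / 2)
    rw [Real.mul_rpow hx.le (by positivity), ← Real.rpow_mul hm.le] at h1
    convert h1 using 3
    field_simp
  have e2 : x ^ (b / 2) ≤ (θ ^ ((b - 2) / b) * g) ^ (b / 2) := by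
    rw [Real.mul_rpow (by positivity) hg, ← Real.rpow_mul hθ0.le]
    have h2 : x ^ (b / 2) = x ^ ((b - 2) / 2) * x := by
      rw [← Real.rpow_add_one hx.ne']
      congr 1
      ring
    have h3 : (b - 2) / b * (b / 2) = (b - 2) / 2 := by field_simp
    rw [h2, h3]
    calc x ^ ((b - 2) / 2) * x ≤ x ^ ((b - 2) / 2) * (m ^ (a / 2) * g ^ (b / 2)) := by gcongr
      _ = (x ^ ((b - 2) / 2) * m ^ (a / 2)) * g ^ (b / 2) := by ring
      _ ≤ _ := by gcongr
  exact (Real.rpow_le_rpow_iff hx.le (by positivity) (by positivity)).1 e2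

/-- A function strictly below the ground state threshold has coercive energy. -/
theorem IsGroundState.coercivity {γ p : ℝ} (hγ0 : 0 < γ) (hγ : γ < 3) (hp : 2 ≤ p)
    (hA : 0 < expA γ p) (hB : 2 < expB γ p) {Q : E3 → ℂ} (hQ : IsGroundState γ p Q)
    {θ : ℝ} (hθ : 0 < θ) {v : E3 → ℂ} (hv : MemH1 v)
    (h : potential γ p v * mass v ^ sigmaCrit γ p ≤
      θ * (potential γ p Q * mass Q ^ sigmaCrit γ p)) :
    expB γ p / (2 * p) * ((θ ^ ((expB γ p - 2) / expB γ p))⁻¹ - 1) * potential γ p v ≤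
      gradSq v - expB γ p / (2 * p) * potential γ p v := by
  have hB0 : 0 < expB γ p := by linarith
  have hPoh := hQ.gradSq_eq hγ0 hγ hp hA.le hB0.le
  have hM := mass_pos hQ.memH1 hQ.ne_zero
  have hG := gradSq_pos hQ.memH1 hQ.ne_zero
  have hP := potential_pos (γ := γ) (by linarith) hQ.memH1
    (hQ.energy_lt_top hγ0 hγ hp hA.le hB0.le hQ.memH1) hQ.ne_zero
  have hgn := hQ.potential_le (by linarith) hv
  rcases (potential_nonneg γ p v).eq_or_lt with h0 | hPv
  · rw [← h0]
    simpa using gradSq_nonneg v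
  have hv0 : ¬ v =ᵐ[volume] 0 := fun h0 => by
    rw [potential_congr h0, potential_zero (by linarith)] at hPv
    exact lt_irrefl _ hPv
  have hMv := mass_pos hv hv0
  have hGv := gradSq_pos hv hv0
  rw [sigmaCrit_eq (by linarith) hB] at h
  have hsq : ∀ {y : ℝ} (r : ℝ), 0 < y → √y ^ r = y ^ (r / 2) := fun {y} r hy => by
    rw [Real.sqrt_eq_rpow, ← Real.rpow_mul hy.le]
    congr 1
    ring
  rw [gnQuotient, hsq _ hMv, hsq _ hGv, hsq _ hM, hsq _ hG] at hgn
  -- Dividing by the quantities of Q normalizes the best constant to 1.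
  have key := le_rpow_mul_of_gn (a := expA γ p) (b := expB γ p)
    (x := potential γ p v / potential γ p Q) (m := mass v / mass Q)
    (g := gradSq v / gradSq Q) (θ := θ) hB (by positivity) (by positivity) (by positivity) ?_ ?_
  · set T := θ ^ ((expB γ p - 2) / expB γ p) with hT
    have hT0 : 0 < T := by positivity
    -- The Pohozaev identity replaces ‖∇Q‖₂² by B/(2p) P(Q), and P(Q) then cancels.
    rw [div_le_iff₀ hP, hPoh] at key
    have hk : potential γ p v ≤ T * gradSq v * (2 * p / expB γ p) := by
      refine key.trans (le_of_eq ?_)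
      field_simp
    have hk2 : expB γ p / (2 * p) * T⁻¹ * potential γ p v ≤ gradSq v := by
      calc _ ≤ expB γ p / (2 * p) * T⁻¹ * (T * gradSq v * (2 * p / expB γ p)) := by gcongr
        _ = gradSq v := by field_simp
    linarith
  · rw [div_le_iff₀ hP, Real.div_rpow hMv.le hM.le, Real.div_rpow hGv.le hG.le]
    refine hgn.trans (le_of_eq ?_)
    field_simp
  · rw [Real.div_rpow hMv.le hM.le, div_mul_div_comm, div_le_iff₀ (by positivity)]
    exact h

end Hartree

end

/-! ### The theorem: choice of δ' and localization to balls -/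

theorem proposition4p1 (γ p : ℝ) (hγ0 : 0 < γ) (hγ3 : γ < 3) (hp2 : 2 ≤ p)
    (hp_low : (5 + γ) / 3 < p) (hp_up : p < 3 + γ) (δ : ℝ) (hδ : 0 < δ) :
    ∃ δ' : ℝ, 0 < δ' ∧
      ∀ Q : Hartree.E3 → ℂ, Hartree.IsGroundState γ p Q →
      ∀ u : Hartree.E3 → ℂ, Hartree.MemH1 u →
        Hartree.potential γ p u * Hartree.mass u ^ Hartree.sigmaCrit γ p
            < (1 - δ) * (Hartree.potential γ p Q * Hartree.mass Q ^ Hartree.sigmaCrit γ p) →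
        (δ' * Hartree.potential γ p u
            ≤ Hartree.gradSq u - Hartree.expB γ p / (2 * p) * Hartree.potential γ p u) ∧
        ∀ χ : Hartree.E3 → ℝ, Hartree.IsCutoff χ → ∀ R : ℝ, 0 < R →
          Hartree.MemH1 (Hartree.localize χ R u) ∧
          δ' * Hartree.potential γ p (Hartree.localize χ R u)
            ≤ Hartree.gradSq (Hartree.localize χ R u)
              - Hartree.expB γ p / (2 * p) * Hartree.potential γ p (Hartree.localize χ R u) := by
  have hA : 0 < Hartree.expA γ p := by
    rw [Hartree.expA]
    linarith
  have hB : 2 < Hartree.expB γ p := by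
    rw [Hartree.expB]
    linarith
  have hσ : 0 ≤ Hartree.sigmaCrit γ p := by
    rw [Hartree.sigmaCrit_eq (by linarith) hB]
    exact div_nonneg hA.le (by linarith)
  have hPM : ∀ w : Hartree.E3 → ℂ,
      0 ≤ Hartree.potential γ p w * Hartree.mass w ^ Hartree.sigmaCrit γ p := fun w =>
    mul_nonneg (Hartree.potential_nonneg _ _ _) (Real.rpow_nonneg (Hartree.mass_nonneg _) _)
  -- For δ ≥ 1 the threshold is nonpositive and no u lies strictly below it, so any positive δ'
  -- serves.
  rcases le_or_gt 1 δ with h1 | h1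
  · refine ⟨1, one_pos, fun Q _ u _ h => absurd h (not_lt.2 ?_)⟩
    exact (mul_nonpos_of_nonpos_of_nonneg (by linarith) (hPM Q)).trans (hPM u)
  have hθ : 0 < 1 - δ := by linarith
  have hT : (1 - δ) ^ ((Hartree.expB γ p - 2) / Hartree.expB γ p) < 1 :=
    Real.rpow_lt_one hθ.le (by linarith) (div_pos (by linarith) (by linarith))
  refine ⟨Hartree.expB γ p / (2 * p) *
    (((1 - δ) ^ ((Hartree.expB γ p - 2) / Hartree.expB γ p))⁻¹ - 1),
    mul_pos (div_pos (by linarith) (by linarith)) ?_, fun Q hQ u hu h =>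
      ⟨hQ.coercivity hγ0 hγ3 hp2 hA hB hθ hu h.le, fun χ hχ R hR => ?_⟩⟩
  · rw [sub_pos]
    exact (one_lt_inv₀ (Real.rpow_pos_of_pos hθ _)).2 hT
  have hv := hu.localize hχ hR
  have hle := Hartree.norm_localize_le hχ R u
  refine ⟨hv, hQ.coercivity hγ0 hγ3 hp2 hA hB hθ hv (le_trans ?_ h.le)⟩
  -- Both P and M decrease under localization and σ_c ≥ 0, so the threshold for u passes to χ_R u
  -- with the same θ.
  exact mul_le_mul
    (Hartree.potential_mono (by linarith) hu.1.1 hv.1.1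
      (hQ.energy_lt_top hγ0 hγ3 hp2 hA.le (by linarith) hu) hle)
    (Real.rpow_le_rpow (Hartree.mass_nonneg _) (Hartree.mass_le_of_norm_le hu.1 hle) hσ)
    (Real.rpow_nonneg (Hartree.mass_nonneg _) _) (Hartree.potential_nonneg _ _ _)
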